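/- **Setting.** For each $k\in\mathbb N$ let $p=p_k\ge 2$, $L=L_k\ge 1$ and $s=s_k\ge 0$ be integers with $p_k\to\infty$ and $\log p_k/L_k\to 0$ as $k\to\infty$. For each $k$ there are $L$ tasks $$y^{(\ell)}=X^{(\ell)}\bar\beta^{(\ell)}+\varepsilon^{(\ell)}\in\mathbb R^{n_\ell},\qquad \ell=1,\dots,L,$$ where all objects, including $n_\ell$, may depend on $k$ (except $\sigma$ and the constants named below). For fixed constants $\tau_\beta,\tau_\varepsilon\ge 0$ and $\gamma_0,c_0,\kappa>0$ not depending on $k$ and $\ell$, assume: 1. (Fixed design.) $X^{(\ell)}\in\mathbb R^{n_\ell\times p}$ is deterministic, $p/n_\ell\ge\gamma_0$, $\lambda_{\max}\big(\tfrac1{n_\ell}X^{(\ell)\top}X^{(\ell)}\big)\le c_0$, and $$\frac1{p^2}\big\|(X^{(\ell)}\otimes X^{(\ell)})\operatorname{vec}(\Delta)\big\|_2^2\ \ge\ \kappa\,\|\Delta\|_F^2\quad\text{for every symmetric }\Delta\in\mathbb R^{p\times p}.$$ 2. (Random effects.) The random vectors $\bar\beta^{(1)},\dots,\bar\beta^{(L)},\varepsilon^{(1)},\dots,\varepsilon^{(L)}$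 are independent with $\mathbb E\bar\beta^{(\ell)}=0$, $\mathbb E\bar\beta^{(\ell)}\bar\beta^{(\ell)\top}=\frac1p\Omega$, $\mathbb E\varepsilon^{(\ell)}=0$, $\mathbb E\varepsilon^{(\ell)}\varepsilon^{(\ell)\top}=\sigma^2I$. The vectors $\sqrt p\,\bar\beta^{(\ell)}$ and $\varepsilon^{(\ell)}$ are sub-Gaussian with parameters $\tau_\beta$ and $\tau_\varepsilon$, where a random vector $x$ is sub-Gaussian with parameter $\tau$ if $\mathbb E\exp(t\,v^\top(x-\mathbb Ex))\le\exp(t^2\tau^2/2)$ for all $t\in\mathbb R$ and all unit vectors $v$. 3. (Sparsity.) $\Omega=\Omega_k\in\mathbb R^{p\times p}$ has at most $s$ nonzero off-diagonal entries. Let $\hat\Omega$ be a minimizer, over the cone $\mathbb S_p^+$ of positive definite matrices, of $$\tilde\Omega\ \mapsto\ \frac1L\sum_{\ell=1}^L\Big\|y^{(\ell)}y^{(\ell)\top}-\frac1pX^{(\ell)}\tilde\Omega X^{(\ell)\top}-\sigma^2I\Big\|_F^2+\tilde\lambda\sum_{i\ne j}|\tilde\Omega_{ij}|,$$ where, since $\mathbb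 S_p^+$ is open, $\hat\Omega$ is allowed to attain the infimum in the closure of $\mathbb S_p^+$. **Theorem.** There is a constant $C_0>0$, depending only on $\tau_\beta,\tau_\varepsilon,\gamma_0,c_0$, such that if $\tilde\lambda\asymp\sqrt{\log p/L}$ with a sufficiently large constant, that is, $$c_1\sqrt{\frac{\log p}{L}}\le\tilde\lambda\le c_2\sqrt{\frac{\log p}{L}}\quad\text{for all }k,\text{ with constants } c_2\ge c_1\ge C_0,$$ then $$\|\hat\Omega-\Omega\|_F=\mathcal O_P\Bigg(\sqrt{\frac{(p+s)\log p}{L}}\Bigg),$$ where $Z_k=\mathcal O_P(b_k)$ means $\sup_k\mathbb P(|Z_k|/b_k>K)\to 0$ as $K\to\infty$. -/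

import Mathlib

open MeasureTheory ProbabilityTheory Filter Topology Matrix
open scoped NNReal ENNReal Kronecker

-- From here on, `‖A‖` for a matrix `A` is its Frobenius norm.
attribute [local instance] Matrix.frobeniusNormedAddCommGroup

namespace HyperCov

noncomputable section

/-- A random vector `x` in `ℝ^d` is sub-Gaussian with parameter `τ`: for every unit vector `v` and
every real `t`, `E exp (t vᵀ(x - E x)) ≤ exp (t² τ² / 2)`, the expectation being finite. -/
def IsSubGaussianVec {S : Type*} [MeasurableSpace S] (μ : Measure S) {d : ℕ}
    (x : S → Fin d → ℝ) (τ : ℝ≥0) : Prop :=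
  ∀ v : Fin d → ℝ, v ⬝ᵥ v = 1 →
    HasSubgaussianMGF (fun ω => v ⬝ᵥ (fun i => x ω i - ∫ ω', x ω' i ∂μ)) (τ ^ 2) μ

/-- `Z_k = O_P(b_k)` (for positive `b_k`): `sup_k P(|Z_k / b_k| > K) → 0` as `K → ∞`.
The variables `Z_k` may live on different probability spaces. -/
def IsBigOP {S : ℕ → Type*} [∀ k, MeasurableSpace (S k)] (μ : ∀ k, Measure (S k))
    (Z : ∀ k, S k → ℝ) (b : ℕ → ℝ) : Prop :=
  Tendsto (fun K : ℝ => ⨆ k, μ k {ω | K < |Z k ω / b k|}) atTop (𝓝 0)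

/-- The sample covariance matrix `n⁻¹ Xᵀ X` of an `n × p` design. -/
def sampleCov {n p : ℕ} (X : Matrix (Fin n) (Fin p) ℝ) : Matrix (Fin p) (Fin p) ℝ :=
  (1 / (n : ℝ)) • (Xᵀ * X)

/-- The response `y = X β + ε` of one task. -/
def response {n p : ℕ} (X : Matrix (Fin n) (Fin p) ℝ) (β : Fin p → ℝ) (ε : Fin n → ℝ) :
    Fin n → ℝ :=
  X *ᵥ β + ε

/-- The positions of the nonzero off-diagonal entries of a matrix. -/
def offDiagSupport {p : ℕ} (A : Matrix (Fin p) (Fin p) ℝ) : Set (Fin p × Fin p) :=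
  {ij | A ij.1 ij.2 ≠ 0 ∧ ij.1 ≠ ij.2}

/-- The `L₁`-penalized least squares objective
`L⁻¹ ∑_ℓ ‖y_ℓ y_ℓᵀ - p⁻¹ X_ℓ W X_ℓᵀ - σ² I‖_F² + lam ∑_{i ≠ j} |W_ij|`. -/
def objective {p L : ℕ} {n : Fin L → ℕ} (X : ∀ ℓ, Matrix (Fin (n ℓ)) (Fin p) ℝ)
    (y : ∀ ℓ, Fin (n ℓ) → ℝ) (σ lam : ℝ) (W : Matrix (Fin p) (Fin p) ℝ) : ℝ :=
  (1 / (L : ℝ)) * ∑ ℓ, ‖vecMulVec (y ℓ) (y ℓ) - (1 / (p : ℝ)) • (X ℓ * W * (X ℓ)ᵀ)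
      - σ ^ 2 • (1 : Matrix (Fin (n ℓ)) (Fin (n ℓ)) ℝ)‖ ^ 2
    + lam * ∑ i, ∑ j ∈ Finset.univ.erase i, |W i j|

/-- `W` attains the infimum of the objective over the positive definite matrices. Since that cone
is open, the infimum need not be attained inside it, so `W` is allowed to lie in its closure, the
positive semidefinite matrices; a positive definite `W` satisfies this exactly if it is a minimizer
of the objective over the positive definite matrices. -/
def IsPenalizedMinimizer {p L : ℕ} {n : Fin L → ℕ} (X : ∀ ℓ, Matrix (Fin (n ℓ)) (Fin p) ℝ)
    (y : ∀ ℓ, Fin (n ℓ) → ℝ) (σ lam : ℝ) (W : Matrix (Fin p) (Fin p) ℝ) : Prop :=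
  W.PosSemidef ∧ ∀ V : Matrix (Fin p) (Fin p) ℝ, V.PosDef →
    objective X y σ lam W ≤ objective X y σ lam V

/-- Deterministic designs `X_ℓ`, `ℓ < L`, in dimension `p`: the ratios `p / n_ℓ` are at least
`γ₀`, the largest eigenvalues of the sample covariances are at most `c₀`, and
`p⁻² ‖(X_ℓ ⊗ X_ℓ) vec Δ‖₂² ≥ κ ‖Δ‖_F²` for all symmetric `Δ`. -/
structure IsFixedDesign {p L : ℕ} {n : Fin L → ℕ} (X : ∀ ℓ, Matrix (Fin (n ℓ)) (Fin p) ℝ)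
    (γ₀ c₀ κ : ℝ) : Prop where
  ratio_lower : ∀ ℓ, γ₀ ≤ (p : ℝ) / (n ℓ : ℝ)
  cov_upper : ∀ ℓ, (c₀ • (1 : Matrix (Fin p) (Fin p) ℝ) - sampleCov (X ℓ)).PosSemidef
  restricted_eigenvalue : ∀ ℓ, ∀ Δ : Matrix (Fin p) (Fin p) ℝ, Δ.IsSymm →
    κ * ‖Δ‖ ^ 2 ≤ (1 / (p : ℝ) ^ 2) * ‖WithLp.toLp 2 ((X ℓ ⊗ₖ X ℓ) *ᵥ vec Δ)‖ ^ 2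

/-- The random coefficients `β_ℓ` and noises `ε_ℓ`, `ℓ < L`: the tasks are independent,
`β_ℓ` and `ε_ℓ` are independent of each other, `E β_ℓ = 0`, `E β_ℓ β_ℓᵀ = p⁻¹ Ω`, `E ε_ℓ = 0`,
`E ε_ℓ ε_ℓᵀ = σ² I`, and `√p β_ℓ`, `ε_ℓ` are sub-Gaussian with parameters `τβ`, `τε`. -/
structure IsRandomEffects {p L : ℕ} {n : Fin L → ℕ} {S : Type*} [MeasurableSpace S]
    (μ : Measure S) (β : Fin L → S → Fin p → ℝ) (ε : ∀ ℓ, S → Fin (n ℓ) → ℝ)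
    (Ω : Matrix (Fin p) (Fin p) ℝ) (σ : ℝ) (τβ τε : ℝ≥0) : Prop where
  measurable_coef : ∀ ℓ, Measurable (β ℓ)
  measurable_noise : ∀ ℓ, Measurable (ε ℓ)
  indep_tasks : iIndepFun (fun ℓ ω => (β ℓ ω, ε ℓ ω)) μ
  indep_coef_noise : ∀ ℓ, IndepFun (β ℓ) (ε ℓ) μ
  mean_coef : ∀ ℓ i, ∫ ω, β ℓ ω i ∂μ = 0
  mean_noise : ∀ ℓ i, ∫ ω, ε ℓ ω i ∂μ = 0
  cov_coef : ∀ ℓ i j, ∫ ω, β ℓ ω i * β ℓ ω j ∂μ = Ω i j / p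
  cov_noise : ∀ ℓ i j, ∫ ω, ε ℓ ω i * ε ℓ ω j ∂μ = if i = j then σ ^ 2 else 0
  subGaussian_coef : ∀ ℓ, IsSubGaussianVec μ (fun ω => √(p : ℝ) • β ℓ ω) τβ
  subGaussian_noise : ∀ ℓ, IsSubGaussianVec μ (ε ℓ) τε

end

end HyperCov

/-!
Comparing the objective at `Ωhat` and at `Ω` and using the restricted eigenvalue condition gives
`κ ‖Δ‖² ≤ ⟨G, Δ⟩ + lam (‖Ω‖₁ - ‖Ωhat‖₁)` for `Δ = Ωhat - Ω`, where `‖·‖₁` runs over off-diagonal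
entries and the score `G` is minus the gradient of the quadratic loss at `Ω`. An entry of `G` is an
average over the tasks of independent centered products of two sub-Gaussian variables, hence of
sub-exponential ones. If `log p ≤ L`, Bernstein's inequality and a union bound over the `p²` entries
show that `lam` dominates all of them with probability at least `1 - 2 / p²`. The entries of `Δ`
outside the diagonal and the support of `Ω` then cancel, and Cauchy-Schwarz on the remaining at most
`p + s` entries gives the rate. This is vacuous for bounded `p`, where Chebyshev's inequality for
the entries of `G` and Cauchy-Schwarz on all `p²` entries of `Δ` suffice.
-/

namespace HyperCov

section SubExponential

variable {S : Type*} [MeasurableSpace S] {μ : Measure S}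

lemma lintegral_exp_mul_gaussianReal (x : ℝ) :
    ∫⁻ g, ENNReal.ofReal (Real.exp (x * g)) ∂(gaussianReal 0 1)
      = ENNReal.ofReal (Real.exp (x ^ 2 / 2)) := by
  rw [← ofReal_integral_eq_lintegral_ofReal (integrable_exp_mul_gaussianReal x)
    (ae_of_all _ fun _ => (Real.exp_pos _).le)]
  have h := congrFun (mgf_fun_id_gaussianReal (μ := 0) (v := 1)) x
  simp only [mgf, zero_mul, zero_add, NNReal.coe_one, one_mul] at h
  rw [h]

lemma lintegral_exp_mul_sq_gaussianReal {a : ℝ} (ha : 2 * a < 1) :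
    ∫⁻ g, ENNReal.ofReal (Real.exp (a * g ^ 2)) ∂(gaussianReal 0 1)
      = ENNReal.ofReal (√(1 - 2 * a))⁻¹ := by
  have hb : 0 < 1 / 2 - a := by linarith
  have hdensity : ∀ g : ℝ, gaussianPDF 0 1 g * ENNReal.ofReal (Real.exp (a * g ^ 2))
      = ENNReal.ofReal ((√(2 * Real.pi))⁻¹ * Real.exp (-(1 / 2 - a) * g ^ 2)) := by
    intro g
    rw [gaussianPDF, ← ENNReal.ofReal_mul (gaussianPDFReal_nonneg _ _ _), gaussianPDFReal,
      mul_assoc, ← Real.exp_add]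
    simp only [NNReal.coe_one, mul_one, sub_zero]
    congr 3
    ring
  rw [gaussianReal_of_var_ne_zero _ one_ne_zero,
    lintegral_withDensity_eq_lintegral_mul _ (measurable_gaussianPDF _ _) (by fun_prop)]
  simp only [Pi.mul_apply, hdensity]
  rw [← ofReal_integral_eq_lintegral_ofReal ((integrable_exp_neg_mul_sq hb).const_mul _)
    (ae_of_all _ fun _ => by positivity), integral_const_mul, integral_gaussian,
    ← Real.sqrt_inv, ← Real.sqrt_mul (by positivity), ← Real.sqrt_inv]
  congr 2
  have : 1 - 2 * a ≠ 0 := by linarith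
  field_simp

-- Writing `exp (t z²)` as the Gaussian average of `exp (√(2t) z g)` reduces the square-exponential
-- moment of `z` to its moment generating function.
lemma lintegral_exp_mul_sq_le [SFinite μ] {z : S → ℝ} {V : ℝ≥0} (hz : HasSubgaussianMGF z V μ)
    {t : ℝ} (ht : 0 ≤ t) (htV : 2 * (t * V) < 1) :
    ∫⁻ ω, ENNReal.ofReal (Real.exp (t * z ω ^ 2)) ∂μ
      ≤ ENNReal.ofReal (√(1 - 2 * (t * V)))⁻¹ := by
  have hr : √(2 * t) ^ 2 = 2 * t := Real.sq_sqrt (by positivity)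
  have hm : AEMeasurable z μ := hz.aemeasurable
  calc ∫⁻ ω, ENNReal.ofReal (Real.exp (t * z ω ^ 2)) ∂μ
      = ∫⁻ ω, ∫⁻ g, ENNReal.ofReal (Real.exp (√(2 * t) * z ω * g)) ∂(gaussianReal 0 1) ∂μ := by
        refine lintegral_congr fun ω => ?_
        rw [lintegral_exp_mul_gaussianReal, mul_pow, hr]
        congr 2
        ring
    _ = ∫⁻ g, ∫⁻ ω, ENNReal.ofReal (Real.exp (√(2 * t) * z ω * g)) ∂μ ∂(gaussianReal 0 1) := by
        rw [lintegral_lintegral_swap]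
        have : AEMeasurable (fun q : S × ℝ => z q.1) (μ.prod (gaussianReal 0 1)) :=
          hm.comp_quasiMeasurePreserving Measure.quasiMeasurePreserving_fst
        simp only [Function.uncurry_def]
        fun_prop
    _ ≤ ∫⁻ g, ENNReal.ofReal (Real.exp (t * V * g ^ 2)) ∂(gaussianReal 0 1) := by
        refine lintegral_mono fun g => ?_
        simp only [mul_right_comm _ _ g]
        rw [← ofReal_integral_eq_lintegral_ofReal (hz.integrable_exp_mul _)
          (ae_of_all _ fun _ => (Real.exp_pos _).le)]
        refine ENNReal.ofReal_le_ofReal ((hz.mgf_le (√(2 * t) * g)).trans_eq ?_)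
        rw [mul_pow, hr]
        congr 1
        ring
    _ = ENNReal.ofReal (√(1 - 2 * (t * V)))⁻¹ := lintegral_exp_mul_sq_gaussianReal htV

/-- The variable `w` is sub-exponential with rate `θ`: `E exp (θ |w|) ≤ 2`, that is, its Orlicz
`ψ₁`-norm is at most `1 / θ`. The expectation is a lower Lebesgue integral, so that the bound
entails integrability. -/
structure IsSubExponential (w : S → ℝ) (θ : ℝ) (μ : Measure S) : Prop where
  aemeasurable : AEMeasurable w μ
  lintegral_exp_le : ∫⁻ ω, ENNReal.ofReal (Real.exp (θ * |w ω|)) ∂μ ≤ 2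

lemma exp_mul_abs_mul_le {θ : ℝ} (hθ : 0 ≤ θ) (x y : ℝ) :
    Real.exp (θ * |x * y|) ≤ (Real.exp (θ * x ^ 2) + Real.exp (θ * y ^ 2)) / 2 := by
  have hsq : ∀ z : ℝ, Real.exp (θ * z ^ 2) = Real.exp (θ * z ^ 2 / 2) ^ 2 := fun z => by
    rw [← Real.exp_nat_mul]
    congr 1
    push_cast
    ring
  have hxy : θ * |x * y| ≤ θ * x ^ 2 / 2 + θ * y ^ 2 / 2 := by
    have : |x * y| ≤ (x ^ 2 + y ^ 2) / 2 := by
      rw [abs_mul]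
      nlinarith [sq_nonneg (|x| - |y|), sq_abs x, sq_abs y]
    nlinarith
  calc Real.exp (θ * |x * y|)
      ≤ Real.exp (θ * x ^ 2 / 2) * Real.exp (θ * y ^ 2 / 2) := by
        rw [← Real.exp_add]
        exact Real.exp_le_exp.2 hxy
    _ ≤ (Real.exp (θ * x ^ 2) + Real.exp (θ * y ^ 2)) / 2 := by
        rw [hsq x, hsq y]
        nlinarith [sq_nonneg (Real.exp (θ * x ^ 2 / 2) - Real.exp (θ * y ^ 2 / 2))]

lemma isSubExponential_mul [SFinite μ] {z z' : S → ℝ} {V : ℝ≥0} (hV : 0 < V)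
    (hz : HasSubgaussianMGF z V μ) (hz' : HasSubgaussianMGF z' V μ) :
    IsSubExponential (fun ω => z ω * z' ω) (3 / (8 * V)) μ := by
  have hm : AEMeasurable z μ := hz.aemeasurable
  have hm' : AEMeasurable z' μ := hz'.aemeasurable
  refine ⟨hm.mul hm', ?_⟩
  set θ : ℝ := 3 / (8 * V)
  have hθ : 0 ≤ θ := by positivity
  have hθV : 2 * (θ * V) = 3 / 4 := by
    simp only [θ]
    field_simp
    norm_num
  have hsq : ∀ {x : S → ℝ}, HasSubgaussianMGF x V μ →
      ∫⁻ ω, ENNReal.ofReal (Real.exp (θ * x ω ^ 2)) ∂μ ≤ 2 := fun hx => by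
    refine (lintegral_exp_mul_sq_le hx hθ (by rw [hθV]; norm_num)).trans_eq ?_
    rw [hθV, show (1 - 3 / 4 : ℝ) = (1 / 2) ^ 2 by norm_num, Real.sqrt_sq (by norm_num)]
    norm_num
  calc ∫⁻ ω, ENNReal.ofReal (Real.exp (θ * |z ω * z' ω|)) ∂μ
      ≤ ∫⁻ ω, (ENNReal.ofReal (Real.exp (θ * z ω ^ 2))
          + ENNReal.ofReal (Real.exp (θ * z' ω ^ 2))) / 2 ∂μ := by
        refine lintegral_mono fun ω => ?_
        refine (ENNReal.ofReal_le_ofReal (exp_mul_abs_mul_le hθ _ _)).trans_eq ?_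
        rw [ENNReal.ofReal_div_of_pos two_pos, ENNReal.ofReal_add (by positivity) (by positivity),
          ENNReal.ofReal_ofNat]
    _ = (∫⁻ ω, ENNReal.ofReal (Real.exp (θ * z ω ^ 2)) ∂μ
          + ∫⁻ ω, ENNReal.ofReal (Real.exp (θ * z' ω ^ 2)) ∂μ) / 2 := by
        simp only [div_eq_mul_inv]
        rw [lintegral_mul_const' _ _ (by simp), lintegral_add_left' (by fun_prop)]
    _ ≤ (2 + 2) / 2 := by gcongr <;> exact hsq ‹_›
    _ = 2 := by
        rw [← two_mul, ENNReal.mul_div_cancel_right two_ne_zero ENNReal.ofNat_ne_top]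

namespace IsSubExponential

variable {w : S → ℝ} {θ : ℝ}

lemma neg (hw : IsSubExponential w θ μ) : IsSubExponential (fun ω => -w ω) θ μ :=
  ⟨hw.aemeasurable.neg, by simpa only [abs_neg] using hw.lintegral_exp_le⟩

lemma integrable_exp_mul_abs (hw : IsSubExponential w θ μ) :
    Integrable (fun ω => Real.exp (θ * |w ω|)) μ := by
  have hm : AEMeasurable w μ := hw.aemeasurable
  refine ⟨AEMeasurable.aestronglyMeasurable (by fun_prop), ?_⟩
  rw [hasFiniteIntegral_iff_ofReal (ae_of_all _ fun _ => (Real.exp_pos _).le)]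
  exact hw.lintegral_exp_le.trans_lt ENNReal.ofNat_lt_top

lemma integral_exp_mul_abs_le (hw : IsSubExponential w θ μ) :
    ∫ ω, Real.exp (θ * |w ω|) ∂μ ≤ 2 := by
  have h := hw.lintegral_exp_le
  rw [← ofReal_integral_eq_lintegral_ofReal hw.integrable_exp_mul_abs
    (ae_of_all _ fun _ => (Real.exp_pos _).le)] at h
  exact ENNReal.ofReal_le_ofNat.1 h

lemma integrable_exp_mul (hw : IsSubExponential w θ μ) {s : ℝ} (hs : |s| ≤ θ) :
    Integrable (fun ω => Real.exp (s * w ω)) μ := by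
  have hm : AEMeasurable w μ := hw.aemeasurable
  refine hw.integrable_exp_mul_abs.mono' (AEMeasurable.aestronglyMeasurable (by fun_prop))
    (ae_of_all _ fun ω => ?_)
  rw [Real.norm_of_nonneg (Real.exp_pos _).le, Real.exp_le_exp]
  calc s * w ω ≤ |s| * |w ω| := (le_abs_self _).trans_eq (abs_mul _ _)
    _ ≤ θ * |w ω| := by gcongr

lemma memLp_two (hw : IsSubExponential w θ μ) (hθ : 0 < θ) : MemLp w 2 μ := by
  rw [memLp_two_iff_integrable_sq hw.aemeasurable.aestronglyMeasurable]
  simpa only [sq_abs] using integrable_pow_abs_of_integrable_exp_mul hθ.ne'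
    (hw.integrable_exp_mul (abs_of_pos hθ).le)
    (hw.integrable_exp_mul (by rw [abs_neg, abs_of_pos hθ])) 2

lemma variance_le [IsProbabilityMeasure μ] (hw : IsSubExponential w θ μ) (hθ : 0 < θ) :
    Var[w; μ] ≤ 4 / θ ^ 2 := by
  have hsq : ∀ ω, w ω ^ 2 ≤ 2 / θ ^ 2 * Real.exp (θ * |w ω|) := fun ω => by
    have h := Real.quadratic_le_exp_of_nonneg (x := θ * |w ω|) (by positivity)
    have h0 : 0 ≤ θ * |w ω| := by positivity
    rw [mul_pow, sq_abs] at h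
    rw [div_mul_eq_mul_div, le_div_iff₀ (by positivity)]
    linarith
  calc Var[w; μ] ≤ ∫ ω, w ω ^ 2 ∂μ :=
        variance_le_expectation_sq hw.aemeasurable.aestronglyMeasurable
    _ ≤ ∫ ω, 2 / θ ^ 2 * Real.exp (θ * |w ω|) ∂μ :=
        integral_mono (hw.memLp_two hθ).integrable_sq (hw.integrable_exp_mul_abs.const_mul _) hsq
    _ ≤ 2 / θ ^ 2 * 2 := by
        rw [integral_const_mul]
        gcongr
        exact hw.integral_exp_mul_abs_le
    _ = 4 / θ ^ 2 := by ring

end IsSubExponential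

lemma exp_le_one_add_add_sq_mul_exp_abs (x : ℝ) :
    Real.exp x ≤ 1 + x + x ^ 2 * Real.exp |x| := by
  have h := Complex.norm_exp_sub_sum_le_norm_mul_exp (x : ℂ) 2
  have htaylor : Complex.exp x - ∑ m ∈ Finset.range 2, (x : ℂ) ^ m / m.factorial
      = ((Real.exp x - (1 + x) : ℝ) : ℂ) := by
    simp [Finset.sum_range_succ]
  rw [htaylor, Complex.norm_real, Complex.norm_real, Real.norm_eq_abs, Real.norm_eq_abs,
    sq_abs] at h
  linarith [le_abs_self (Real.exp x - (1 + x))]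

lemma exp_mul_le_one_add_mul_add {θ s : ℝ} (hθ : 0 < θ) (hs : |s| ≤ θ / 2) (x : ℝ) :
    Real.exp (s * x) ≤ 1 + s * x + s ^ 2 * (8 / θ ^ 2) * Real.exp (θ * |x|) := by
  have hexp : Real.exp |s * x| ≤ Real.exp (θ / 2 * |x|) := by
    rw [abs_mul]
    gcongr
  have hsq : x ^ 2 ≤ 8 / θ ^ 2 * Real.exp (θ / 2 * |x|) := by
    have h := Real.quadratic_le_exp_of_nonneg (x := θ / 2 * |x|) (by positivity)
    have h0 : 0 ≤ θ / 2 * |x| := by positivity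
    rw [mul_pow, sq_abs] at h
    rw [div_mul_eq_mul_div, le_div_iff₀ (by positivity)]
    linarith
  have hsplit : Real.exp (θ * |x|) = Real.exp (θ / 2 * |x|) * Real.exp (θ / 2 * |x|) := by
    rw [← Real.exp_add]
    congr 1
    ring
  calc Real.exp (s * x) ≤ 1 + s * x + s ^ 2 * x ^ 2 * Real.exp |s * x| := by
        rw [← mul_pow]
        exact exp_le_one_add_add_sq_mul_exp_abs _
    _ ≤ 1 + s * x + s ^ 2 * (8 / θ ^ 2 * Real.exp (θ / 2 * |x|)) * Real.exp (θ / 2 * |x|) := by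
        gcongr
    _ = _ := by
        rw [hsplit]
        ring

lemma IsSubExponential.mgf_le [IsProbabilityMeasure μ] {w : S → ℝ} {θ s : ℝ}
    (hw : IsSubExponential w θ μ) (hθ : 0 < θ) (hs : |s| ≤ θ / 2) :
    mgf w μ s ≤ Real.exp (s * (∫ ω, w ω ∂μ) + 16 / θ ^ 2 * s ^ 2) := by
  have hint : Integrable w μ := (hw.memLp_two hθ).integrable one_le_two
  have hlin : Integrable (fun ω => 1 + s * w ω) μ := (integrable_const _).add (hint.const_mul s)
  have hquad := hw.integrable_exp_mul_abs.const_mul (s ^ 2 * (8 / θ ^ 2))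
  calc mgf w μ s
      ≤ ∫ ω, (1 + s * w ω + s ^ 2 * (8 / θ ^ 2) * Real.exp (θ * |w ω|)) ∂μ :=
        integral_mono (hw.integrable_exp_mul (hs.trans (by linarith))) (hlin.add hquad)
          fun ω => exp_mul_le_one_add_mul_add hθ hs (w ω)
    _ = 1 + s * (∫ ω, w ω ∂μ) + s ^ 2 * (8 / θ ^ 2) * ∫ ω, Real.exp (θ * |w ω|) ∂μ := by
        rw [integral_add hlin hquad, integral_add (integrable_const _) (hint.const_mul s),
          integral_const_mul, integral_const_mul, integral_const, probReal_univ, one_smul]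
    _ ≤ 1 + s * (∫ ω, w ω ∂μ) + s ^ 2 * (8 / θ ^ 2) * 2 := by
        gcongr
        exact hw.integral_exp_mul_abs_le
    _ = s * (∫ ω, w ω ∂μ) + 16 / θ ^ 2 * s ^ 2 + 1 := by ring
    _ ≤ _ := Real.add_one_le_exp _

end SubExponential

section Concentration

variable {S : Type*} [MeasurableSpace S] {μ : Measure S} [IsProbabilityMeasure μ] {ι : Type*}
  [Fintype ι] {w : ι → S → ℝ} {θ c : ℝ}

lemma measureReal_le_sum_sub_integral_le (hind : iIndepFun w μ)
    (hw : ∀ i, IsSubExponential (w i) θ μ) (hθ : 0 < θ) (hc : 0 ≤ c)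
    (hcard : c * θ ≤ 16 * Fintype.card ι) :
    μ.real {ω | c ≤ ∑ i, (w i ω - ∫ ω', w i ω' ∂μ)}
      ≤ Real.exp (-(c ^ 2 * θ ^ 2 / (64 * Fintype.card ι))) := by
  rcases isEmpty_or_nonempty ι with hι | hι
  · simp
  set s : ℝ := c * θ ^ 2 / (32 * Fintype.card ι) with hs_def
  have hs0 : 0 ≤ s := by positivity
  have hs : |s| ≤ θ / 2 := by
    rw [abs_of_nonneg hs0, hs_def, div_le_iff₀ (by positivity)]
    nlinarith
  have hmgf := hind.mgf_sum₀ (t := s) (fun i => (hw i).aemeasurable) Finset.univ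
  have hint : Integrable (fun ω => Real.exp (s * (∑ i, w i) ω)) μ := by
    refine .of_integral_ne_zero (hmgf.trans_ne (Finset.prod_pos fun i _ => ?_).ne')
    exact mgf_pos ((hw i).integrable_exp_mul (hs.trans (by linarith)))
  calc μ.real {ω | c ≤ ∑ i, (w i ω - ∫ ω', w i ω' ∂μ)}
      = μ.real {ω | c + ∑ i, ∫ ω', w i ω' ∂μ ≤ (∑ i, w i) ω} := by
        simp only [Finset.sum_sub_distrib, Finset.sum_apply, le_sub_iff_add_le]
    _ ≤ Real.exp (-s * (c + ∑ i, ∫ ω', w i ω' ∂μ)) * ∏ i, mgf (w i) μ s := by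
        rw [← hmgf]
        exact measure_ge_le_exp_mul_mgf _ hs0 hint
    _ ≤ Real.exp (-s * (c + ∑ i, ∫ ω', w i ω' ∂μ))
          * ∏ i, Real.exp (s * (∫ ω, w i ω ∂μ) + 16 / θ ^ 2 * s ^ 2) := by
        gcongr with i
        · exact fun i _ => mgf_nonneg
        · exact (hw i).mgf_le hθ hs
    _ = _ := by
        rw [← Real.exp_sum, ← Real.exp_add, Finset.sum_add_distrib, ← Finset.mul_sum,
          Finset.sum_const, Finset.card_univ, nsmul_eq_mul, hs_def]
        congr 1
        field_simp
        ring

lemma measureReal_le_abs_sum_sub_integral_le (hind : iIndepFun w μ)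
    (hw : ∀ i, IsSubExponential (w i) θ μ) (hθ : 0 < θ) (hc : 0 ≤ c)
    (hcard : c * θ ≤ 16 * Fintype.card ι) :
    μ.real {ω | c ≤ |∑ i, (w i ω - ∫ ω', w i ω' ∂μ)|}
      ≤ 2 * Real.exp (-(c ^ 2 * θ ^ 2 / (64 * Fintype.card ι))) := by
  have hupper := measureReal_le_sum_sub_integral_le hind hw hθ hc hcard
  have hlower := measureReal_le_sum_sub_integral_le
    (hind.comp (fun _ x => -x) fun _ => measurable_neg) (fun i => (hw i).neg) hθ hc hcard
  have hneg : ∀ ω, ∑ i, (((fun x => -x) ∘ w i) ω - ∫ ω', ((fun x => -x) ∘ w i) ω' ∂μ)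
      = -∑ i, (w i ω - ∫ ω', w i ω' ∂μ) := fun ω => by
    simp only [Function.comp_apply, integral_neg, ← Finset.sum_neg_distrib]
    exact Finset.sum_congr rfl fun i _ => by ring
  simp only [hneg] at hlower
  simp only [le_abs, Set.ofPred_or]
  exact (measureReal_union_le _ _).trans (by linarith)

lemma measure_le_abs_sum_sub_integral_le_div_sq (hind : iIndepFun w μ)
    (hw : ∀ i, IsSubExponential (w i) θ μ) (hθ : 0 < θ) (hc : 0 < c) :
    μ {ω | c ≤ |∑ i, (w i ω - ∫ ω', w i ω' ∂μ)|}
      ≤ ENNReal.ofReal (Fintype.card ι * (4 / θ ^ 2) / c ^ 2) := by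
  have hL2 : ∀ i, MemLp (w i) 2 μ := fun i => (hw i).memLp_two hθ
  have hmean : ∀ ω, ∑ i, (w i ω - ∫ ω', w i ω' ∂μ) = (∑ i, w i) ω - μ[∑ i, w i] := fun ω => by
    simp only [Finset.sum_apply, Finset.sum_sub_distrib]
    rw [integral_finsetSum _ fun i _ => (hL2 i).integrable one_le_two]
  have hvar : Var[∑ i, w i; μ] ≤ Fintype.card ι * (4 / θ ^ 2) := by
    rw [IndepFun.variance_sum (fun i _ => hL2 i) fun i _ j _ hij => hind.indepFun hij,
      ← nsmul_eq_mul, ← Finset.card_univ]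
    exact Finset.sum_le_card_nsmul _ _ _ fun i _ => (hw i).variance_le hθ
  simp only [hmean]
  refine (meas_ge_le_variance_div_sq (memLp_finsetSum' _ fun i _ => hL2 i) hc).trans ?_
  gcongr

end Concentration

section RandomVector

variable {S : Type*} [MeasurableSpace S] {μ : Measure S}

lemma hasSubgaussianMGF_mono {z : S → ℝ} {V V' : ℝ≥0} (hz : HasSubgaussianMGF z V μ)
    (hV : V ≤ V') : HasSubgaussianMGF z V' μ where
  integrable_exp_mul := hz.integrable_exp_mul
  mgf_le t := (hz.mgf_le t).trans (by gcongr)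

section

variable {d : ℕ} {x : S → Fin d → ℝ} {τ : ℝ≥0} [IsProbabilityMeasure μ]

lemma IsSubGaussianVec.hasSubgaussianMGF_dotProduct (hx : IsSubGaussianVec μ x τ)
    (hmean : ∀ i, ∫ ω, x ω i ∂μ = 0) {v : Fin d → ℝ} {V : ℝ≥0} (hV : v ⬝ᵥ v * τ ^ 2 ≤ V) :
    HasSubgaussianMGF (fun ω => v ⬝ᵥ x ω) V μ := by
  rcases eq_or_ne v 0 with rfl | hv
  · simpa only [zero_dotProduct] using
      hasSubgaussianMGF_mono (HasSubgaussianMGF.fun_zero (μ := μ)) (zero_le (a := V))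
  have hpos : 0 < v ⬝ᵥ v := by simpa using dotProduct_star_self_pos_iff.2 hv
  have hr2 : √(v ⬝ᵥ v) ^ 2 = v ⬝ᵥ v := Real.sq_sqrt hpos.le
  set r : ℝ := √(v ⬝ᵥ v)
  have hr : r ≠ 0 := (Real.sqrt_pos.2 hpos).ne'
  have hunit : (r⁻¹ • v) ⬝ᵥ (r⁻¹ • v) = 1 := by
    rw [smul_dotProduct, dotProduct_smul, smul_eq_mul, smul_eq_mul, ← hr2]
    field_simp
  have hrescale : (fun ω => r * ((r⁻¹ • v) ⬝ᵥ fun i => x ω i - ∫ ω', x ω' i ∂μ))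
      = fun ω => v ⬝ᵥ x ω := by
    funext ω
    simp only [hmean, sub_zero, smul_dotProduct, smul_eq_mul]
    rw [mul_inv_cancel_left₀ hr]
  refine hasSubgaussianMGF_mono (hrescale ▸ (hx _ hunit).const_mul r) ?_
  rwa [← hr2] at hV

lemma IsSubGaussianVec.memLp_two (hx : IsSubGaussianVec μ x τ) (hmean : ∀ i, ∫ ω, x ω i ∂μ = 0)
    (i : Fin d) : MemLp (fun ω => x ω i) 2 μ := by
  have h := (hx.hasSubgaussianMGF_dotProduct hmean (v := Pi.single i 1) (V := τ ^ 2)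
    (by simp)).memLp 2
  simpa only [single_one_dotProduct, ENNReal.coe_ofNat] using h

end

/-- The matrix `E x zᵀ` of mixed second moments of two random vectors. For centered vectors it is
their cross-covariance matrix. -/
noncomputable def crossMoment {a b : Type*} (μ : Measure S) (x : S → a → ℝ) (z : S → b → ℝ) :
    Matrix a b ℝ :=
  of fun i j => ∫ ω, x ω i * z ω j ∂μ

variable {a b c : Type*} {x x' : S → a → ℝ} {z : S → b → ℝ}

lemma crossMoment_transpose (x : S → a → ℝ) (z : S → b → ℝ) :
    (crossMoment μ x z)ᵀ = crossMoment μ z x := by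
  ext i j
  simp only [crossMoment, transpose_apply, of_apply, mul_comm]

lemma crossMoment_add_left (hx : ∀ i, MemLp (fun ω => x ω i) 2 μ)
    (hx' : ∀ i, MemLp (fun ω => x' ω i) 2 μ) (hz : ∀ j, MemLp (fun ω => z ω j) 2 μ) :
    crossMoment μ (fun ω => x ω + x' ω) z = crossMoment μ x z + crossMoment μ x' z := by
  ext i j
  simp only [crossMoment, of_apply, Matrix.add_apply, Pi.add_apply, add_mul]
  exact integral_add ((hx i).integrable_mul (hz j)) ((hx' i).integrable_mul (hz j))

lemma crossMoment_add_right (hx : ∀ i, MemLp (fun ω => x ω i) 2 μ)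
    (hx' : ∀ i, MemLp (fun ω => x' ω i) 2 μ) (hz : ∀ j, MemLp (fun ω => z ω j) 2 μ) :
    crossMoment μ z (fun ω => x ω + x' ω) = crossMoment μ z x + crossMoment μ z x' := by
  rw [← crossMoment_transpose, crossMoment_add_left hx hx' hz, transpose_add,
    crossMoment_transpose, crossMoment_transpose]

section

variable [Fintype a]

lemma crossMoment_mulVec_left (A : Matrix c a ℝ) (hx : ∀ i, MemLp (fun ω => x ω i) 2 μ)
    (hz : ∀ j, MemLp (fun ω => z ω j) 2 μ) :
    crossMoment μ (fun ω => A *ᵥ x ω) z = A * crossMoment μ x z := by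
  ext i j
  have hint : ∀ k, Integrable (fun ω => A i k * (x ω k * z ω j)) μ := fun k =>
    ((hx k).integrable_mul (hz j)).const_mul _
  simp only [crossMoment, of_apply, mul_apply, mulVec, dotProduct, Finset.sum_mul, mul_assoc]
  rw [integral_finsetSum _ fun k _ => hint k]
  simp only [integral_const_mul]

lemma crossMoment_mulVec_right (A : Matrix c a ℝ) (hx : ∀ i, MemLp (fun ω => x ω i) 2 μ)
    (hz : ∀ j, MemLp (fun ω => z ω j) 2 μ) :
    crossMoment μ z (fun ω => A *ᵥ x ω) = crossMoment μ z x * Aᵀ := by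
  rw [← crossMoment_transpose, crossMoment_mulVec_left A hx hz, transpose_mul,
    crossMoment_transpose]

lemma memLp_two_dotProduct (hx : ∀ i, MemLp (fun ω => x ω i) 2 μ) (u : a → ℝ) :
    MemLp (fun ω => u ⬝ᵥ x ω) 2 μ :=
  memLp_finsetSum _ fun i _ => (hx i).const_mul _

lemma integral_dotProduct_mul_dotProduct (hx : ∀ i, MemLp (fun ω => x ω i) 2 μ) (u v : a → ℝ) :
    ∫ ω, (u ⬝ᵥ x ω) * (v ⬝ᵥ x ω) ∂μ = u ⬝ᵥ (crossMoment μ x x *ᵥ v) := by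
  have hu : ∀ j, MemLp (fun ω => (of (fun _ : Unit => u) *ᵥ x ω) j) 2 μ := fun _ =>
    memLp_two_dotProduct hx u
  have h := congrFun₂ (crossMoment_mulVec_right (of fun _ : Unit => v) hx hu) () ()
  rw [crossMoment_mulVec_left (of fun _ : Unit => u) hx hx, Matrix.mul_assoc] at h
  exact h

end

lemma posSemidef_crossMoment_self [Finite a] (hx : ∀ i, MemLp (fun ω => x ω i) 2 μ) :
    (crossMoment μ x x).PosSemidef := by
  have := Fintype.ofFinite a
  refine PosSemidef.of_dotProduct_mulVec_nonneg ?_ fun u => ?_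
  · rw [IsHermitian, conjTranspose_eq_transpose_of_trivial, crossMoment_transpose]
  · rw [star_trivial, ← integral_dotProduct_mul_dotProduct hx]
    exact integral_nonneg fun ω => mul_self_nonneg _

end RandomVector

section Design

lemma transpose_mulVec_dotProduct_self_le {m d : Type*} [Fintype m] [Fintype d]
    {X : Matrix m d ℝ} {C : ℝ} (hC : 0 ≤ C) (hX : ∀ a, (X *ᵥ a) ⬝ᵥ (X *ᵥ a) ≤ C * (a ⬝ᵥ a))
    (u : m → ℝ) : (Xᵀ *ᵥ u) ⬝ᵥ (Xᵀ *ᵥ u) ≤ C * (u ⬝ᵥ u) := by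
  set a := Xᵀ *ᵥ u with ha_def
  have hadjoint : a ⬝ᵥ a = u ⬝ᵥ (X *ᵥ a) := by
    rw [dotProduct_mulVec u, ← mulVec_transpose, ← ha_def]
  have hcauchy : (u ⬝ᵥ (X *ᵥ a)) ^ 2 ≤ (u ⬝ᵥ u) * ((X *ᵥ a) ⬝ᵥ (X *ᵥ a)) := by
    simpa only [dotProduct, ← sq] using Finset.sum_mul_sq_le_sq_mul_sq Finset.univ u (X *ᵥ a)
  have hu : 0 ≤ u ⬝ᵥ u := by simpa using dotProduct_star_self_nonneg u
  have ha : 0 ≤ a ⬝ᵥ a := by simpa using dotProduct_star_self_nonneg a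
  rcases ha.eq_or_lt with ha | ha
  · rw [← ha]
    positivity
  · have hsq := hcauchy.trans (mul_le_mul_of_nonneg_left (hX a) hu)
    rw [← hadjoint, sq] at hsq
    nlinarith

/-- The `i`-th column of the design divided by `√p`, the direction in which the score sees the
response. -/
noncomputable def scaledCol {m p : ℕ} (X : Matrix (Fin m) (Fin p) ℝ) (i : Fin p) : Fin m → ℝ :=
  (√(p : ℝ))⁻¹ • X.col i

lemma dotProduct_response {m p : ℕ} (X : Matrix (Fin m) (Fin p) ℝ) (b : Fin p → ℝ)
    (e u : Fin m → ℝ) : u ⬝ᵥ response X b e = (Xᵀ *ᵥ u) ⬝ᵥ b + u ⬝ᵥ e := by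
  rw [response, dotProduct_add, dotProduct_mulVec, ← mulVec_transpose]

variable {p L : ℕ} {n : Fin L → ℕ} {X : ∀ ℓ, Matrix (Fin (n ℓ)) (Fin p) ℝ} {γ₀ c₀ κ : ℝ}

namespace IsFixedDesign

lemma natCast_pos (hX : IsFixedDesign X γ₀ c₀ κ) (hγ₀ : 0 < γ₀) (ℓ : Fin L) : (0 : ℝ) < n ℓ := by
  refine (Nat.cast_nonneg _).lt_of_ne fun h0 => ?_
  have h := hX.ratio_lower ℓ
  rw [← h0, div_zero] at h
  linarith

lemma natCast_le (hX : IsFixedDesign X γ₀ c₀ κ) (hγ₀ : 0 < γ₀) (ℓ : Fin L) :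
    (n ℓ : ℝ) ≤ p / γ₀ := by
  have h := hX.ratio_lower ℓ
  rwa [le_div_comm₀ hγ₀ (hX.natCast_pos hγ₀ ℓ)] at h

lemma mulVec_dotProduct_self_le (hX : IsFixedDesign X γ₀ c₀ κ) (hγ₀ : 0 < γ₀) (hc₀ : 0 ≤ c₀)
    (ℓ : Fin L) (a : Fin p → ℝ) :
    (X ℓ *ᵥ a) ⬝ᵥ (X ℓ *ᵥ a) ≤ c₀ / γ₀ * p * (a ⬝ᵥ a) := by
  have hn := hX.natCast_pos hγ₀ ℓ
  have ha : 0 ≤ a ⬝ᵥ a := by simpa using dotProduct_star_self_nonneg a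
  have hquad : a ⬝ᵥ (((X ℓ)ᵀ * X ℓ) *ᵥ a) = (X ℓ *ᵥ a) ⬝ᵥ (X ℓ *ᵥ a) := by
    rw [← mulVec_mulVec, dotProduct_mulVec a, ← mulVec_transpose, transpose_transpose]
  have heig : (X ℓ *ᵥ a) ⬝ᵥ (X ℓ *ᵥ a) / n ℓ ≤ c₀ * (a ⬝ᵥ a) := by
    have h := (hX.cov_upper ℓ).dotProduct_mulVec_nonneg a
    simp only [star_trivial, sampleCov, sub_mulVec, smul_mulVec, one_mulVec, dotProduct_sub,
      dotProduct_smul, smul_eq_mul, hquad] at h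
    rw [div_eq_inv_mul, ← one_div]
    linarith
  calc (X ℓ *ᵥ a) ⬝ᵥ (X ℓ *ᵥ a) ≤ c₀ * (a ⬝ᵥ a) * n ℓ := (div_le_iff₀ hn).1 heig
    _ ≤ c₀ * (a ⬝ᵥ a) * (p / γ₀) := by
        gcongr
        exact hX.natCast_le hγ₀ ℓ
    _ = c₀ / γ₀ * p * (a ⬝ᵥ a) := by ring

lemma scaledCol_dotProduct_self_le (hX : IsFixedDesign X γ₀ c₀ κ) (hγ₀ : 0 < γ₀) (hc₀ : 0 ≤ c₀)
    (ℓ : Fin L) (i : Fin p) : scaledCol (X ℓ) i ⬝ᵥ scaledCol (X ℓ) i ≤ c₀ / γ₀ := by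
  have hp : (0 : ℝ) < p := by exact_mod_cast i.pos
  have h := hX.mulVec_dotProduct_self_le hγ₀ hc₀ ℓ (Pi.single i 1)
  rw [mulVec_single_one, single_one_dotProduct, Pi.single_eq_same, mul_one] at h
  rw [scaledCol, smul_dotProduct, dotProduct_smul, smul_eq_mul, smul_eq_mul, ← mul_assoc,
    ← mul_inv, Real.mul_self_sqrt hp.le, inv_mul_le_iff₀ hp]
  linarith

end IsFixedDesign

end Design

section Score

/-- The second moment matrix `p⁻¹ X Ω Xᵀ + σ² I` that the model prescribes for the response of one
task. -/
noncomputable def modelCov {m p : ℕ} (X : Matrix (Fin m) (Fin p) ℝ) (Ω : Matrix (Fin p) (Fin p) ℝ)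
    (σ : ℝ) : Matrix (Fin m) (Fin m) ℝ :=
  (1 / (p : ℝ)) • (X * Ω * Xᵀ) + σ ^ 2 • (1 : Matrix (Fin m) (Fin m) ℝ)

/-- The contribution of one task to the score, without the factor `2 / L`. -/
noncomputable def taskScore {m p : ℕ} (X : Matrix (Fin m) (Fin p) ℝ) (y : Fin m → ℝ)
    (Ω : Matrix (Fin p) (Fin p) ℝ) (σ : ℝ) : Matrix (Fin p) (Fin p) ℝ :=
  (1 / (p : ℝ)) • (Xᵀ * (vecMulVec y y - modelCov X Ω σ) * X)

lemma taskScore_apply {m p : ℕ} (X : Matrix (Fin m) (Fin p) ℝ) (y : Fin m → ℝ)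
    (Ω : Matrix (Fin p) (Fin p) ℝ) (σ : ℝ) (i j : Fin p) :
    taskScore X y Ω σ i j = (scaledCol X i ⬝ᵥ y) * (scaledCol X j ⬝ᵥ y)
      - scaledCol X i ⬝ᵥ (modelCov X Ω σ *ᵥ scaledCol X j) := by
  have hentry : ∀ M : Matrix (Fin m) (Fin m) ℝ,
      (Xᵀ * M * X) i j = X.col i ⬝ᵥ (M *ᵥ X.col j) := fun M => by
    rw [Matrix.mul_assoc]
    rfl
  have hp : (√(p : ℝ))⁻¹ * (√(p : ℝ))⁻¹ = 1 / (p : ℝ) := by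
    rw [← mul_inv, Real.mul_self_sqrt (Nat.cast_nonneg _), one_div]
  rw [taskScore, Matrix.smul_apply, hentry, sub_mulVec, dotProduct_sub, vecMulVec_mulVec]
  simp only [scaledCol, smul_dotProduct, mulVec_smul, dotProduct_smul, smul_eq_mul,
    op_smul_eq_smul, ← hp]
  rw [dotProduct_comm y (X.col j)]
  ring

variable {p L : ℕ} {n : Fin L → ℕ} {X : ∀ ℓ, Matrix (Fin (n ℓ)) (Fin p) ℝ} {γ₀ c₀ κ : ℝ}

/-- The negative gradient at `Ω` of the least squares part of the objective. -/
noncomputable def score (X : ∀ ℓ, Matrix (Fin (n ℓ)) (Fin p) ℝ) (y : ∀ ℓ, Fin (n ℓ) → ℝ)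
    (Ω : Matrix (Fin p) (Fin p) ℝ) (σ : ℝ) : Matrix (Fin p) (Fin p) ℝ :=
  (2 / (L : ℝ)) • ∑ ℓ, taskScore (X ℓ) (y ℓ) Ω σ

variable {S : Type*} [MeasurableSpace S] {μ : Measure S} {β : Fin L → S → Fin p → ℝ}
  {ε : ∀ ℓ, S → Fin (n ℓ) → ℝ} {Ω : Matrix (Fin p) (Fin p) ℝ} {σ : ℝ} {τβ τε : ℝ≥0}

/-- The score at `Ω` when the data are the responses to random coefficients and noises. -/
noncomputable def sampleScore (X : ∀ ℓ, Matrix (Fin (n ℓ)) (Fin p) ℝ) (β : Fin L → S → Fin p → ℝ)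
    (ε : ∀ ℓ, S → Fin (n ℓ) → ℝ) (Ω : Matrix (Fin p) (Fin p) ℝ) (σ : ℝ) (ω : S) :
    Matrix (Fin p) (Fin p) ℝ :=
  score X (fun ℓ => response (X ℓ) (β ℓ ω) (ε ℓ ω)) Ω σ

/-- A variance proxy of the responses in the directions `scaledCol`. The summand `1` only makes it
positive. -/
noncomputable def responseProxy (τβ τε : ℝ≥0) (γ₀ c₀ : ℝ) : ℝ≥0 :=
  (c₀ / γ₀).toNNReal ^ 2 * τβ ^ 2 + (c₀ / γ₀).toNNReal * τε ^ 2 + 1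

lemma responseProxy_pos (τβ τε : ℝ≥0) (γ₀ c₀ : ℝ) : 0 < responseProxy τβ τε γ₀ c₀ := by
  unfold responseProxy
  positivity

/-- The exponent with which the products of two responses are sub-exponential, see
`isSubExponential_mul`. -/
noncomputable def scoreExponent (τβ τε : ℝ≥0) (γ₀ c₀ : ℝ) : ℝ :=
  3 / (8 * responseProxy τβ τε γ₀ c₀)

lemma scoreExponent_pos (τβ τε : ℝ≥0) (γ₀ c₀ : ℝ) : 0 < scoreExponent τβ τε γ₀ c₀ := by
  have : (0 : ℝ) < responseProxy τβ τε γ₀ c₀ := responseProxy_pos τβ τε γ₀ c₀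
  unfold scoreExponent
  positivity

namespace IsRandomEffects

lemma crossMoment_coef (h : IsRandomEffects μ β ε Ω σ τβ τε) (ℓ : Fin L) :
    crossMoment μ (β ℓ) (β ℓ) = (1 / (p : ℝ)) • Ω := by
  ext i j
  rw [crossMoment, of_apply, h.cov_coef, Matrix.smul_apply, smul_eq_mul, one_div_mul_eq_div]

lemma crossMoment_noise (h : IsRandomEffects μ β ε Ω σ τβ τε) (ℓ : Fin L) :
    crossMoment μ (ε ℓ) (ε ℓ) = σ ^ 2 • (1 : Matrix (Fin (n ℓ)) (Fin (n ℓ)) ℝ) := by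
  ext i j
  rw [crossMoment, of_apply, h.cov_noise, Matrix.smul_apply, one_apply, smul_eq_mul, mul_ite,
    mul_one, mul_zero]

lemma crossMoment_coef_noise (h : IsRandomEffects μ β ε Ω σ τβ τε) (ℓ : Fin L) :
    crossMoment μ (β ℓ) (ε ℓ) = 0 := by
  ext i j
  have hind : IndepFun (fun ω => β ℓ ω i) (fun ω => ε ℓ ω j) μ :=
    (h.indep_coef_noise ℓ).comp (measurable_pi_apply i) (measurable_pi_apply j)
  rw [crossMoment, of_apply, hind.integral_fun_mul_eq_mul_integral
    ((measurable_pi_apply i).comp (h.measurable_coef ℓ)).aestronglyMeasurable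
    ((measurable_pi_apply j).comp (h.measurable_noise ℓ)).aestronglyMeasurable,
    h.mean_coef, zero_mul, Matrix.zero_apply]

lemma mean_sqrt_smul_coef (h : IsRandomEffects μ β ε Ω σ τβ τε) (ℓ : Fin L) (i : Fin p) :
    ∫ ω, (√(p : ℝ) • β ℓ ω) i ∂μ = 0 := by
  simp only [Pi.smul_apply, smul_eq_mul, integral_const_mul, h.mean_coef, mul_zero]

lemma iIndepFun_mul_response (h : IsRandomEffects μ β ε Ω σ τβ τε) (i j : Fin p) :
    iIndepFun (fun ℓ ω => (scaledCol (X ℓ) i ⬝ᵥ response (X ℓ) (β ℓ ω) (ε ℓ ω))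
      * (scaledCol (X ℓ) j ⬝ᵥ response (X ℓ) (β ℓ ω) (ε ℓ ω))) μ := by
  refine h.indep_tasks.comp (fun ℓ q => (scaledCol (X ℓ) i ⬝ᵥ response (X ℓ) q.1 q.2)
    * (scaledCol (X ℓ) j ⬝ᵥ response (X ℓ) q.1 q.2)) fun ℓ => ?_
  simp only [dotProduct_response]
  unfold dotProduct
  fun_prop

variable [IsProbabilityMeasure μ]

lemma memLp_coef (h : IsRandomEffects μ β ε Ω σ τβ τε) (ℓ : Fin L) (i : Fin p) :
    MemLp (fun ω => β ℓ ω i) 2 μ := by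
  have hp : √(p : ℝ) ≠ 0 := (Real.sqrt_pos.2 (Nat.cast_pos.2 i.pos)).ne'
  simpa only [Pi.smul_apply, smul_eq_mul, inv_mul_cancel_left₀ hp] using
    ((h.subGaussian_coef ℓ).memLp_two (h.mean_sqrt_smul_coef ℓ) i).const_mul (√(p : ℝ))⁻¹

lemma memLp_noise (h : IsRandomEffects μ β ε Ω σ τβ τε) (ℓ : Fin L) (i : Fin (n ℓ)) :
    MemLp (fun ω => ε ℓ ω i) 2 μ :=
  (h.subGaussian_noise ℓ).memLp_two (h.mean_noise ℓ) i

lemma posSemidef (h : IsRandomEffects μ β ε Ω σ τβ τε) (hp : 0 < p) (ℓ : Fin L) :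
    Ω.PosSemidef := by
  have hΩ : Ω = (p : ℝ) • crossMoment μ (β ℓ) (β ℓ) := by
    rw [h.crossMoment_coef, smul_smul, mul_one_div_cancel (Nat.cast_ne_zero.2 hp.ne'), one_smul]
  rw [hΩ]
  exact (posSemidef_crossMoment_self (h.memLp_coef ℓ)).smul (Nat.cast_nonneg p)

lemma memLp_response (h : IsRandomEffects μ β ε Ω σ τβ τε) (ℓ : Fin L) (i : Fin (n ℓ)) :
    MemLp (fun ω => response (X ℓ) (β ℓ ω) (ε ℓ ω) i) 2 μ :=
  (memLp_two_dotProduct (h.memLp_coef ℓ) _).add (h.memLp_noise ℓ i)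

lemma crossMoment_response (h : IsRandomEffects μ β ε Ω σ τβ τε) (ℓ : Fin L) :
    crossMoment μ (fun ω => response (X ℓ) (β ℓ ω) (ε ℓ ω))
      (fun ω => response (X ℓ) (β ℓ ω) (ε ℓ ω)) = modelCov (X ℓ) Ω σ := by
  have hβ := h.memLp_coef ℓ
  have hε := h.memLp_noise ℓ
  have hXβ : ∀ i, MemLp (fun ω => (X ℓ *ᵥ β ℓ ω) i) 2 μ := fun i => memLp_two_dotProduct hβ _
  have hy : ∀ i, MemLp (fun ω => (X ℓ *ᵥ β ℓ ω + ε ℓ ω) i) 2 μ := h.memLp_response ℓ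
  simp only [response]
  rw [crossMoment_add_left hXβ hε hy, crossMoment_add_right hXβ hε hXβ,
    crossMoment_add_right hXβ hε hε, crossMoment_mulVec_left _ hβ hXβ,
    crossMoment_mulVec_left _ hβ hε, crossMoment_mulVec_right _ hβ hβ,
    crossMoment_mulVec_right _ hβ hε, h.crossMoment_coef, h.crossMoment_noise,
    h.crossMoment_coef_noise, ← crossMoment_transpose (β ℓ), h.crossMoment_coef_noise]
  simp only [modelCov, transpose_zero, Matrix.mul_zero, Matrix.zero_mul, add_zero, zero_add,
    Matrix.smul_mul, Matrix.mul_smul, Matrix.mul_assoc]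

lemma sampleScore_apply (h : IsRandomEffects μ β ε Ω σ τβ τε) (i j : Fin p) (ω : S) :
    sampleScore X β ε Ω σ ω i j = 2 / L * ∑ ℓ,
      ((scaledCol (X ℓ) i ⬝ᵥ response (X ℓ) (β ℓ ω) (ε ℓ ω))
          * (scaledCol (X ℓ) j ⬝ᵥ response (X ℓ) (β ℓ ω) (ε ℓ ω))
        - ∫ ω', (scaledCol (X ℓ) i ⬝ᵥ response (X ℓ) (β ℓ ω') (ε ℓ ω'))
          * (scaledCol (X ℓ) j ⬝ᵥ response (X ℓ) (β ℓ ω') (ε ℓ ω')) ∂μ) := by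
  rw [sampleScore, score, Matrix.smul_apply, Matrix.sum_apply, smul_eq_mul]
  simp only [taskScore_apply, integral_dotProduct_mul_dotProduct (h.memLp_response _),
    h.crossMoment_response]

lemma hasSubgaussianMGF_dotProduct_coef (h : IsRandomEffects μ β ε Ω σ τβ τε) (hp : 0 < p)
    (ℓ : Fin L) {v : Fin p → ℝ} {V : ℝ≥0} (hV : v ⬝ᵥ v * τβ ^ 2 ≤ p * V) :
    HasSubgaussianMGF (fun ω => v ⬝ᵥ β ℓ ω) V μ := by
  have hp : (0 : ℝ) < p := Nat.cast_pos.2 hp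
  have hv : ((√(p : ℝ))⁻¹ • v) ⬝ᵥ ((√(p : ℝ))⁻¹ • v) * τβ ^ 2 ≤ V := by
    rwa [smul_dotProduct, dotProduct_smul, smul_eq_mul, smul_eq_mul, ← mul_assoc, ← mul_inv,
      Real.mul_self_sqrt hp.le, mul_assoc, inv_mul_le_iff₀ hp]
  have hsqrt : √(p : ℝ) ≠ 0 := (Real.sqrt_pos.2 hp).ne'
  simpa only [smul_dotProduct, dotProduct_smul, smul_eq_mul, mul_inv_cancel_left₀ hsqrt] using
    (h.subGaussian_coef ℓ).hasSubgaussianMGF_dotProduct (h.mean_sqrt_smul_coef ℓ) hv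

lemma hasSubgaussianMGF_scaledCol_dotProduct_response (h : IsRandomEffects μ β ε Ω σ τβ τε)
    (hX : IsFixedDesign X γ₀ c₀ κ) (hγ₀ : 0 < γ₀) (hc₀ : 0 ≤ c₀) (ℓ : Fin L) (i : Fin p) :
    HasSubgaussianMGF (fun ω => scaledCol (X ℓ) i ⬝ᵥ response (X ℓ) (β ℓ ω) (ε ℓ ω))
      (responseProxy τβ τε γ₀ c₀) μ := by
  have hr : 0 ≤ c₀ / γ₀ := by positivity
  set u := scaledCol (X ℓ) i
  have hu : u ⬝ᵥ u ≤ c₀ / γ₀ := hX.scaledCol_dotProduct_self_le hγ₀ hc₀ ℓ i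
  have hXu : ((X ℓ)ᵀ *ᵥ u) ⬝ᵥ ((X ℓ)ᵀ *ᵥ u) ≤ p * (c₀ / γ₀) ^ 2 :=
    calc ((X ℓ)ᵀ *ᵥ u) ⬝ᵥ ((X ℓ)ᵀ *ᵥ u) ≤ c₀ / γ₀ * p * (u ⬝ᵥ u) :=
          transpose_mulVec_dotProduct_self_le (by positivity)
            (hX.mulVec_dotProduct_self_le hγ₀ hc₀ ℓ) u
      _ ≤ c₀ / γ₀ * p * (c₀ / γ₀) := by gcongr
      _ = p * (c₀ / γ₀) ^ 2 := by ring
  have hcoef : HasSubgaussianMGF (fun ω => ((X ℓ)ᵀ *ᵥ u) ⬝ᵥ β ℓ ω)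
      ((c₀ / γ₀).toNNReal ^ 2 * τβ ^ 2) μ :=
    h.hasSubgaussianMGF_dotProduct_coef i.pos ℓ (by
      push_cast
      rw [Real.coe_toNNReal _ hr, ← mul_assoc]
      gcongr)
  have hnoise : HasSubgaussianMGF (fun ω => u ⬝ᵥ ε ℓ ω) ((c₀ / γ₀).toNNReal * τε ^ 2) μ :=
    (h.subGaussian_noise ℓ).hasSubgaussianMGF_dotProduct (h.mean_noise ℓ) (by
      push_cast
      rw [Real.coe_toNNReal _ hr]
      gcongr)
  have hind : IndepFun (fun ω => ((X ℓ)ᵀ *ᵥ u) ⬝ᵥ β ℓ ω) (fun ω => u ⬝ᵥ ε ℓ ω) μ :=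
    (h.indep_coef_noise ℓ).comp (φ := fun b => ((X ℓ)ᵀ *ᵥ u) ⬝ᵥ b) (ψ := fun e => u ⬝ᵥ e)
      (by unfold dotProduct; fun_prop) (by unfold dotProduct; fun_prop)
  simpa only [dotProduct_response, responseProxy, u] using
    hasSubgaussianMGF_mono (hcoef.add_of_indepFun hnoise hind) le_self_add

lemma isSubExponential_mul_response (h : IsRandomEffects μ β ε Ω σ τβ τε)
    (hX : IsFixedDesign X γ₀ c₀ κ) (hγ₀ : 0 < γ₀) (hc₀ : 0 ≤ c₀) (ℓ : Fin L) (i j : Fin p) :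
    IsSubExponential (fun ω => (scaledCol (X ℓ) i ⬝ᵥ response (X ℓ) (β ℓ ω) (ε ℓ ω))
      * (scaledCol (X ℓ) j ⬝ᵥ response (X ℓ) (β ℓ ω) (ε ℓ ω))) (scoreExponent τβ τε γ₀ c₀) μ :=
  isSubExponential_mul (responseProxy_pos τβ τε γ₀ c₀)
    (h.hasSubgaussianMGF_scaledCol_dotProduct_response hX hγ₀ hc₀ ℓ i)
    (h.hasSubgaussianMGF_scaledCol_dotProduct_response hX hγ₀ hc₀ ℓ j)

lemma setOf_le_abs_sampleScore (h : IsRandomEffects μ β ε Ω σ τβ τε) (hL : 0 < L) (i j : Fin p)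
    (t : ℝ) :
    {ω | t ≤ |sampleScore X β ε Ω σ ω i j|} = {ω | L * t / 2 ≤ |∑ ℓ,
      ((scaledCol (X ℓ) i ⬝ᵥ response (X ℓ) (β ℓ ω) (ε ℓ ω))
          * (scaledCol (X ℓ) j ⬝ᵥ response (X ℓ) (β ℓ ω) (ε ℓ ω))
        - ∫ ω', (scaledCol (X ℓ) i ⬝ᵥ response (X ℓ) (β ℓ ω') (ε ℓ ω'))
          * (scaledCol (X ℓ) j ⬝ᵥ response (X ℓ) (β ℓ ω') (ε ℓ ω')) ∂μ)|} := by
  ext ω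
  simp only [Set.mem_ofPred_eq]
  rw [h.sampleScore_apply, abs_mul, abs_of_pos (by positivity : (0 : ℝ) < 2 / L),
    ← div_le_iff₀' (by positivity), div_div_eq_mul_div, mul_comm t]

lemma measureReal_le_abs_sampleScore_le (h : IsRandomEffects μ β ε Ω σ τβ τε)
    (hX : IsFixedDesign X γ₀ c₀ κ) (hγ₀ : 0 < γ₀) (hc₀ : 0 ≤ c₀) (hL : 0 < L) (i j : Fin p)
    {t : ℝ} (ht : 0 ≤ t) (htop : t * scoreExponent τβ τε γ₀ c₀ ≤ 32) :
    μ.real {ω | t ≤ |sampleScore X β ε Ω σ ω i j|}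
      ≤ 2 * Real.exp (-(L * t ^ 2 * scoreExponent τβ τε γ₀ c₀ ^ 2 / 256)) := by
  rw [h.setOf_le_abs_sampleScore hL]
  refine (measureReal_le_abs_sum_sub_integral_le (h.iIndepFun_mul_response i j)
    (fun ℓ => h.isSubExponential_mul_response hX hγ₀ hc₀ ℓ i j) (scoreExponent_pos τβ τε γ₀ c₀)
    (by positivity) ?_).trans_eq ?_
  · rw [Fintype.card_fin]
    nlinarith
  · rw [Fintype.card_fin]
    congr 3
    field_simp
    ring

lemma measure_le_abs_sampleScore_le_div_sq (h : IsRandomEffects μ β ε Ω σ τβ τε)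
    (hX : IsFixedDesign X γ₀ c₀ κ) (hγ₀ : 0 < γ₀) (hc₀ : 0 ≤ c₀) (hL : 0 < L) (i j : Fin p)
    {t : ℝ} (ht : 0 < t) :
    μ {ω | t ≤ |sampleScore X β ε Ω σ ω i j|}
      ≤ ENNReal.ofReal (16 / (L * scoreExponent τβ τε γ₀ c₀ ^ 2 * t ^ 2)) := by
  have hθ := scoreExponent_pos τβ τε γ₀ c₀
  rw [h.setOf_le_abs_sampleScore hL]
  refine (measure_le_abs_sum_sub_integral_le_div_sq (h.iIndepFun_mul_response i j)
    (fun ℓ => h.isSubExponential_mul_response hX hγ₀ hc₀ ℓ i j) hθ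
    (by positivity)).trans_eq ?_
  rw [Fintype.card_fin]
  congr 1
  field_simp
  ring

end IsRandomEffects

end Score

section Frobenius

variable {a b : Type*} [Fintype a] [Fintype b]

lemma frobenius_norm_sq (A : Matrix a b ℝ) : ‖A‖ ^ 2 = ∑ i, ∑ j, A i j ^ 2 := by
  rw [frobenius_norm_def, ← Real.sqrt_eq_rpow, Real.sq_sqrt (by positivity)]
  simp only [Real.norm_eq_abs, Real.rpow_ofNat, sq_abs]

lemma trace_transpose_mul (A B : Matrix a b ℝ) : (Aᵀ * B).trace = ∑ i, ∑ j, A i j * B i j := by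
  rw [Finset.sum_comm]
  rfl

lemma frobenius_norm_sub_sq (A B : Matrix a b ℝ) :
    ‖A - B‖ ^ 2 = ‖A‖ ^ 2 - 2 * (Aᵀ * B).trace + ‖B‖ ^ 2 := by
  simp only [frobenius_norm_sq, trace_transpose_mul, Finset.mul_sum, ← Finset.sum_sub_distrib,
    ← Finset.sum_add_distrib, Matrix.sub_apply, sub_sq, mul_assoc]

lemma trace_transpose_mul_conj (N : Matrix a a ℝ) (X : Matrix a b ℝ) (Δ : Matrix b b ℝ) :
    (Nᵀ * (X * Δ * Xᵀ)).trace = ((Xᵀ * N * X)ᵀ * Δ).trace := by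
  rw [transpose_mul, transpose_mul, transpose_transpose, ← Matrix.mul_assoc, trace_mul_comm]
  simp only [Matrix.mul_assoc]

lemma norm_kronecker_mulVec_vec_sq {m d : ℕ} (X : Matrix (Fin m) (Fin d) ℝ)
    (Δ : Matrix (Fin d) (Fin d) ℝ) :
    ‖WithLp.toLp 2 ((X ⊗ₖ X) *ᵥ vec Δ)‖ ^ 2 = ‖X * Δ * Xᵀ‖ ^ 2 := by
  rw [kronecker_mulVec_vec, EuclideanSpace.norm_sq_eq, frobenius_norm_sq, Fintype.sum_prod_type,
    Finset.sum_comm]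
  simp only [vec, Real.norm_eq_abs, sq_abs]

lemma sum_abs_le_sqrt_card_mul_norm (A : Matrix a b ℝ) (T : Finset (a × b)) :
    ∑ ij ∈ T, |A ij.1 ij.2| ≤ √(T.card : ℝ) * ‖A‖ := by
  have hT : ∑ ij ∈ T, |A ij.1 ij.2| ^ 2 ≤ ‖A‖ ^ 2 := by
    rw [frobenius_norm_sq, ← Fintype.sum_prod_type' fun i j => A i j ^ 2]
    simp only [sq_abs]
    exact Finset.sum_le_univ_sum_of_nonneg fun _ => sq_nonneg _
  refine le_of_sq_le_sq ?_ (by positivity)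
  rw [mul_pow, Real.sq_sqrt (Nat.cast_nonneg _)]
  exact sq_sum_le_card_mul_sum_sq.trans (by gcongr)

lemma trace_transpose_mul_le_mul_sum_abs {A : Matrix a b ℝ} {M : ℝ} (hA : ∀ i j, |A i j| ≤ M)
    (B : Matrix a b ℝ) : (Aᵀ * B).trace ≤ M * ∑ ij : a × b, |B ij.1 ij.2| := by
  rw [trace_transpose_mul, ← Fintype.sum_prod_type' fun i j => A i j * B i j, Finset.mul_sum]
  refine Finset.sum_le_sum fun ij _ => ?_
  calc A ij.1 ij.2 * B ij.1 ij.2 ≤ |A ij.1 ij.2| * |B ij.1 ij.2| :=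
        (le_abs_self _).trans (abs_mul _ _).le
    _ ≤ M * |B ij.1 ij.2| := by
        gcongr
        exact hA _ _

end Frobenius

section BasicInequality

variable {p : ℕ} {Ω W : Matrix (Fin p) (Fin p) ℝ}

/-- The `ℓ₁` norm of the off-diagonal part of a matrix, which is the penalty in `objective`. -/
def offDiagL1 (W : Matrix (Fin p) (Fin p) ℝ) : ℝ :=
  ∑ i, ∑ j ∈ Finset.univ.erase i, |W i j|

lemma offDiagL1_eq_sum_ite (W : Matrix (Fin p) (Fin p) ℝ) :
    offDiagL1 W = ∑ ij : Fin p × Fin p, if ij.1 = ij.2 then 0 else |W ij.1 ij.2| := by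
  rw [offDiagL1, Fintype.sum_prod_type]
  refine Finset.sum_congr rfl fun i _ => ?_
  refine Eq.trans (Finset.sum_congr rfl fun j hj => ?_) (Finset.sum_erase _ (if_pos rfl))
  exact (if_neg (Finset.ne_of_mem_erase hj).symm).symm

lemma offDiagL1_sub_le {T : Finset (Fin p × Fin p)} (hT : ∀ ij ∉ T, ij.1 ≠ ij.2 ∧ Ω ij.1 ij.2 = 0)
    (W : Matrix (Fin p) (Fin p) ℝ) :
    offDiagL1 Ω - offDiagL1 W
      ≤ ∑ ij ∈ T, |(W - Ω) ij.1 ij.2| - ∑ ij ∈ Tᶜ, |(W - Ω) ij.1 ij.2| := by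
  have hsplit : ∑ ij ∈ T, |(W - Ω) ij.1 ij.2| - ∑ ij ∈ Tᶜ, |(W - Ω) ij.1 ij.2|
      = ∑ ij, if ij ∈ T then |(W - Ω) ij.1 ij.2| else -|(W - Ω) ij.1 ij.2| := by
    rw [Finset.sum_ite, Finset.sum_neg_distrib, Finset.filter_univ_mem,
      Finset.filter_notMem_eq_sdiff, Finset.compl_eq_univ_sdiff, sub_eq_add_neg]
  rw [hsplit, offDiagL1_eq_sum_ite, offDiagL1_eq_sum_ite, ← Finset.sum_sub_distrib]
  refine Finset.sum_le_sum fun ij _ => ?_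
  by_cases hij : ij ∈ T
  · rw [if_pos hij, Matrix.sub_apply, abs_sub_comm]
    split_ifs
    · rw [sub_zero]
      exact abs_nonneg _
    · exact abs_sub_abs_le_abs_sub _ _
  · obtain ⟨hne, hzero⟩ := hT ij hij
    rw [if_neg hij, if_neg hne, if_neg hne, Matrix.sub_apply, hzero, abs_zero, zero_sub, sub_zero]

/-- The positions where a matrix is allowed to be nonzero: the diagonal and the off-diagonal
support. -/
noncomputable def activeSet (Ω : Matrix (Fin p) (Fin p) ℝ) : Finset (Fin p × Fin p) :=
  Finset.univ.diag ∪ (Set.toFinite (offDiagSupport Ω)).toFinset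

lemma card_activeSet_le (Ω : Matrix (Fin p) (Fin p) ℝ) :
    (activeSet Ω).card ≤ p + (offDiagSupport Ω).ncard := by
  refine (Finset.card_union_le _ _).trans_eq ?_
  rw [Finset.diag_card, Finset.card_fin, Set.ncard_eq_toFinset_card]

lemma ne_and_eq_zero_of_notMem_activeSet (Ω : Matrix (Fin p) (Fin p) ℝ) (ij : Fin p × Fin p)
    (hij : ij ∉ activeSet Ω) : ij.1 ≠ ij.2 ∧ Ω ij.1 ij.2 = 0 := by
  simp only [activeSet, offDiagSupport, Finset.mem_union, Finset.mem_diag, Finset.mem_univ,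
    true_and, Set.Finite.mem_toFinset, Set.mem_ofPred_eq, not_or, not_and_or, not_not] at hij
  exact ⟨hij.1, hij.2.resolve_right hij.1⟩

lemma mul_le_of_mul_sq_le_mul {a b x : ℝ} (hx : 0 ≤ x) (hb : 0 ≤ b) (h : a * x ^ 2 ≤ b * x) :
    a * x ≤ b := by
  rcases hx.eq_or_lt with rfl | hx
  · rwa [mul_zero]
  · refine le_of_mul_le_mul_right ?_ hx
    rwa [mul_assoc, ← sq]

variable {L : ℕ} {n : Fin L → ℕ} {X : ∀ ℓ, Matrix (Fin (n ℓ)) (Fin p) ℝ} {γ₀ c₀ κ : ℝ}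
  {y : ∀ ℓ, Fin (n ℓ) → ℝ} {σ lam : ℝ}

lemma objective_eq_norm_sub_modelCov (X : ∀ ℓ, Matrix (Fin (n ℓ)) (Fin p) ℝ)
    (y : ∀ ℓ, Fin (n ℓ) → ℝ) (σ lam : ℝ) (W : Matrix (Fin p) (Fin p) ℝ) :
    objective X y σ lam W
      = (1 / (L : ℝ)) * ∑ ℓ, ‖vecMulVec (y ℓ) (y ℓ) - modelCov (X ℓ) W σ‖ ^ 2
        + lam * offDiagL1 W := by
  simp only [objective, modelCov, offDiagL1, sub_sub]

lemma norm_sub_modelCov_sq {m : ℕ} (X : Matrix (Fin m) (Fin p) ℝ) (y : Fin m → ℝ) (σ : ℝ)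
    (Ω W : Matrix (Fin p) (Fin p) ℝ) :
    ‖vecMulVec y y - modelCov X W σ‖ ^ 2 = ‖vecMulVec y y - modelCov X Ω σ‖ ^ 2
      - 2 * ((taskScore X y Ω σ)ᵀ * (W - Ω)).trace
      + 1 / (p : ℝ) ^ 2 * ‖X * (W - Ω) * Xᵀ‖ ^ 2 := by
  have hW : modelCov X W σ = modelCov X Ω σ + (1 / (p : ℝ)) • (X * (W - Ω) * Xᵀ) := by
    rw [modelCov, modelCov, Matrix.mul_sub, Matrix.sub_mul, smul_sub]
    abel
  have hnorm : ‖(1 / (p : ℝ)) • (X * (W - Ω) * Xᵀ)‖ ^ 2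
      = 1 / (p : ℝ) ^ 2 * ‖X * (W - Ω) * Xᵀ‖ ^ 2 := by
    simp only [frobenius_norm_sq, Finset.mul_sum, Matrix.smul_apply, smul_eq_mul, mul_pow,
      one_div, inv_pow]
  rw [hW, ← sub_sub, frobenius_norm_sub_sq, hnorm, Matrix.mul_smul, trace_smul,
    trace_transpose_mul_conj, ← trace_smul, ← Matrix.smul_mul, ← transpose_smul, taskScore]

lemma objective_eq_add (X : ∀ ℓ, Matrix (Fin (n ℓ)) (Fin p) ℝ) (y : ∀ ℓ, Fin (n ℓ) → ℝ)
    (σ lam : ℝ) (Ω W : Matrix (Fin p) (Fin p) ℝ) :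
    objective X y σ lam W = objective X y σ lam Ω - ((score X y Ω σ)ᵀ * (W - Ω)).trace
      + (1 / (L : ℝ)) * ∑ ℓ, 1 / (p : ℝ) ^ 2 * ‖X ℓ * (W - Ω) * (X ℓ)ᵀ‖ ^ 2
      + lam * (offDiagL1 W - offDiagL1 Ω) := by
  have hscore : ((score X y Ω σ)ᵀ * (W - Ω)).trace
      = (1 / (L : ℝ)) * ∑ ℓ, 2 * ((taskScore (X ℓ) (y ℓ) Ω σ)ᵀ * (W - Ω)).trace := by
    rw [score, transpose_smul, Matrix.smul_mul, trace_smul, transpose_sum, Matrix.sum_mul,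
      trace_sum, smul_eq_mul, ← Finset.mul_sum, ← mul_assoc, one_div_mul_eq_div]
  simp only [objective_eq_norm_sub_modelCov, norm_sub_modelCov_sq _ _ _ Ω W,
    Finset.sum_add_distrib, Finset.sum_sub_distrib, hscore]
  ring

lemma continuous_objective (X : ∀ ℓ, Matrix (Fin (n ℓ)) (Fin p) ℝ) (y : ∀ ℓ, Fin (n ℓ) → ℝ)
    (σ lam : ℝ) : Continuous (objective X y σ lam) := by
  unfold objective
  fun_prop

lemma IsFixedDesign.mul_norm_sq_le_average (hX : IsFixedDesign X γ₀ c₀ κ) (hL : 0 < L)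
    {Δ : Matrix (Fin p) (Fin p) ℝ} (hΔ : Δ.IsSymm) :
    κ * ‖Δ‖ ^ 2 ≤ (1 / (L : ℝ)) * ∑ ℓ, 1 / (p : ℝ) ^ 2 * ‖X ℓ * Δ * (X ℓ)ᵀ‖ ^ 2 := by
  have hL : (0 : ℝ) < L := Nat.cast_pos.2 hL
  have hsum := Finset.card_nsmul_le_sum Finset.univ _ _ fun ℓ _ => hX.restricted_eigenvalue ℓ Δ hΔ
  simp only [norm_kronecker_mulVec_vec_sq, Finset.card_fin, nsmul_eq_mul] at hsum
  rwa [one_div_mul_eq_div, le_div_iff₀' hL]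

namespace IsPenalizedMinimizer

lemma objective_le_of_posSemidef (hW : IsPenalizedMinimizer X y σ lam W) (hΩ : Ω.PosSemidef) :
    objective X y σ lam W ≤ objective X y σ lam Ω := by
  have hpath : Tendsto (fun t : ℝ => objective X y σ lam (Ω + t • 1)) (𝓝[>] 0)
      (𝓝 (objective X y σ lam Ω)) := by
    have hcont : Continuous fun t : ℝ => objective X y σ lam (Ω + t • 1) :=
      (continuous_objective X y σ lam).comp (by fun_prop)
    simpa only [zero_smul, add_zero] using (hcont.tendsto 0).mono_left nhdsWithin_le_nhds
  exact ge_of_tendsto hpath (eventually_mem_nhdsWithin.mono fun t ht =>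
    hW.2 _ (PosDef.posSemidef_add hΩ (PosDef.one.smul ht)))

lemma mul_norm_sub_sq_le (hW : IsPenalizedMinimizer X y σ lam W) (hΩ : Ω.PosSemidef)
    (hX : IsFixedDesign X γ₀ c₀ κ) (hL : 0 < L) :
    κ * ‖W - Ω‖ ^ 2
      ≤ ((score X y Ω σ)ᵀ * (W - Ω)).trace + lam * (offDiagL1 Ω - offDiagL1 W) := by
  have hsymm : (W - Ω).IsSymm := by
    simpa only [IsHermitian, conjTranspose_eq_transpose_of_trivial, Matrix.IsSymm]
      using hW.1.1.sub hΩ.1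
  have hcurv := hX.mul_norm_sq_le_average hL hsymm
  have hle := hW.objective_le_of_posSemidef hΩ
  rw [objective_eq_add X y σ lam Ω W] at hle
  linarith

lemma mul_norm_sub_sq_le_sum_abs (hW : IsPenalizedMinimizer X y σ lam W) (hΩ : Ω.PosSemidef)
    (hX : IsFixedDesign X γ₀ c₀ κ) (hL : 0 < L) (hlam : 0 ≤ lam) {M : ℝ}
    (hM : ∀ i j, |score X y Ω σ i j| ≤ M) {T : Finset (Fin p × Fin p)}
    (hT : ∀ ij ∉ T, ij.1 ≠ ij.2 ∧ Ω ij.1 ij.2 = 0) :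
    κ * ‖W - Ω‖ ^ 2 ≤ (M + lam) * ∑ ij ∈ T, |(W - Ω) ij.1 ij.2|
      + (M - lam) * ∑ ij ∈ Tᶜ, |(W - Ω) ij.1 ij.2| := by
  have hbasic := hW.mul_norm_sub_sq_le hΩ hX hL
  have hscore := trace_transpose_mul_le_mul_sum_abs hM (W - Ω)
  rw [← Finset.sum_add_sum_compl T] at hscore
  have hpenalty := mul_le_mul_of_nonneg_left (offDiagL1_sub_le hT W) hlam
  linarith

lemma mul_norm_sub_le_of_abs_score_le (hW : IsPenalizedMinimizer X y σ lam W)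
    (hΩ : Ω.PosSemidef) (hX : IsFixedDesign X γ₀ c₀ κ) (hL : 0 < L) (hlam : 0 ≤ lam)
    (hscore : ∀ i j, |score X y Ω σ i j| ≤ lam) :
    κ * ‖W - Ω‖ ≤ 2 * lam * √((p : ℝ) + (offDiagSupport Ω).ncard) := by
  refine mul_le_of_mul_sq_le_mul (norm_nonneg _) (by positivity) ?_
  calc κ * ‖W - Ω‖ ^ 2 ≤ (lam + lam) * ∑ ij ∈ activeSet Ω, |(W - Ω) ij.1 ij.2|
        + (lam - lam) * ∑ ij ∈ (activeSet Ω)ᶜ, |(W - Ω) ij.1 ij.2| :=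
        hW.mul_norm_sub_sq_le_sum_abs hΩ hX hL hlam hscore (ne_and_eq_zero_of_notMem_activeSet Ω)
    _ = 2 * lam * ∑ ij ∈ activeSet Ω, |(W - Ω) ij.1 ij.2| := by ring
    _ ≤ 2 * lam * (√((activeSet Ω).card : ℝ) * ‖W - Ω‖) := by
        gcongr
        exact sum_abs_le_sqrt_card_mul_norm _ _
    _ ≤ 2 * lam * (√((p : ℝ) + (offDiagSupport Ω).ncard) * ‖W - Ω‖) := by
        gcongr
        exact_mod_cast card_activeSet_le Ω
    _ = 2 * lam * √((p : ℝ) + (offDiagSupport Ω).ncard) * ‖W - Ω‖ := by ring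

lemma mul_norm_sub_le (hW : IsPenalizedMinimizer X y σ lam W) (hΩ : Ω.PosSemidef)
    (hX : IsFixedDesign X γ₀ c₀ κ) (hL : 0 < L) (hlam : 0 ≤ lam) {M : ℝ} (hM0 : 0 ≤ M)
    (hM : ∀ i j, |score X y Ω σ i j| ≤ M) : κ * ‖W - Ω‖ ≤ (M + lam) * p := by
  refine mul_le_of_mul_sq_le_mul (norm_nonneg _) (by positivity) ?_
  have hsq := hW.mul_norm_sub_sq_le_sum_abs hΩ hX hL hlam hM (T := Finset.univ)
    fun ij hij => absurd (Finset.mem_univ ij) hij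
  have hcauchy := sum_abs_le_sqrt_card_mul_norm (W - Ω) Finset.univ
  rw [Finset.card_univ, Fintype.card_prod, Fintype.card_fin, Nat.cast_mul,
    Real.sqrt_mul_self (Nat.cast_nonneg p)] at hcauchy
  rw [Finset.compl_univ, Finset.sum_empty, mul_zero, add_zero] at hsq
  refine hsq.trans ?_
  rw [mul_assoc]
  gcongr

end IsPenalizedMinimizer

end BasicInequality

section Rate

lemma isBigOP_of_forall_exists {S : ℕ → Type*} [∀ k, MeasurableSpace (S k)] {μ : ∀ k, Measure (S k)}
    {Z : ∀ k, S k → ℝ} {b : ℕ → ℝ}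
    (h : ∀ δ : ℝ, 0 < δ → ∃ K : ℝ, ∀ k, μ k {ω | K < |Z k ω / b k|} ≤ ENNReal.ofReal δ) :
    IsBigOP μ Z b := by
  rw [IsBigOP, ENNReal.tendsto_nhds_zero]
  intro η hη
  obtain ⟨δ, -, hδ, hδη⟩ := ENNReal.lt_iff_exists_real_btwn.1 hη
  obtain ⟨K, hK⟩ := h δ (ENNReal.ofReal_pos.1 hδ)
  filter_upwards [eventually_ge_atTop K] with K' hKK'
  refine iSup_le fun k => (measure_mono fun ω hω => ?_).trans ((hK k).trans hδη.le)
  exact hKK'.trans_lt hω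

lemma isBigOP_of_large_of_bounded {S : ℕ → Type*} [∀ k, MeasurableSpace (S k)]
    {μ : ∀ k, Measure (S k)} {Z : ∀ k, S k → ℝ} {b : ℕ → ℝ} {p : ℕ → ℕ}
    (hlarge : ∀ δ : ℝ, 0 < δ → ∃ (P : ℕ) (K : ℝ), ∀ k, P < p k →
      μ k {ω | K < |Z k ω / b k|} ≤ ENNReal.ofReal δ)
    (hbounded : ∀ δ : ℝ, 0 < δ → ∀ P : ℕ, ∃ K : ℝ, ∀ k, p k ≤ P →
      μ k {ω | K < |Z k ω / b k|} ≤ ENNReal.ofReal δ) :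
    IsBigOP μ Z b := by
  refine isBigOP_of_forall_exists fun δ hδ => ?_
  obtain ⟨P, K₁, hK₁⟩ := hlarge δ hδ
  obtain ⟨K₂, hK₂⟩ := hbounded δ hδ P
  refine ⟨max K₁ K₂, fun k => ?_⟩
  rcases lt_or_ge P (p k) with hk | hk
  · exact (measure_mono fun ω hω => (le_max_left K₁ K₂).trans_lt hω).trans (hK₁ k hk)
  · exact (measure_mono fun ω hω => (le_max_right K₁ K₂).trans_lt hω).trans (hK₂ k hk)

lemma exists_forall_lt_imp_of_eventually {Q : ℕ → Prop} (hQ : ∀ᶠ k in atTop, Q k) (p : ℕ → ℕ) :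
    ∃ P, ∀ k, P < p k → Q k := by
  obtain ⟨k₀, hk₀⟩ := eventually_atTop.1 hQ
  refine ⟨(Finset.range k₀).sup p, fun k hk => hk₀ k (not_lt.1 fun hlt => ?_)⟩
  exact hk.not_ge (Finset.le_sup (Finset.mem_range.2 hlt))

lemma measure_exists_lt_abs_apply_le {S : Type*} [MeasurableSpace S] {μ : Measure S} {p : ℕ}
    {A : S → Matrix (Fin p) (Fin p) ℝ} {t : ℝ} {r : ℝ≥0∞}
    (hA : ∀ i j, μ {ω | t ≤ |A ω i j|} ≤ r) :
    μ {ω | ∃ i j, t < |A ω i j|} ≤ (p : ℝ≥0∞) ^ 2 * r := by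
  have hsub : {ω | ∃ i j, t < |A ω i j|}
      ⊆ ⋃ ij : Fin p × Fin p, {ω | t ≤ |A ω ij.1 ij.2|} := by
    rintro ω ⟨i, j, hij⟩
    exact Set.mem_iUnion.2 ⟨(i, j), hij.le⟩
  calc μ {ω | ∃ i j, t < |A ω i j|}
      ≤ ∑ ij : Fin p × Fin p, μ {ω | t ≤ |A ω ij.1 ij.2|} :=
        (measure_mono hsub).trans (measure_iUnion_fintype_le _ _)
    _ ≤ ∑ _ij : Fin p × Fin p, r := Finset.sum_le_sum fun ij _ => hA ij.1 ij.2
    _ = (p : ℝ≥0∞) ^ 2 * r := by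
        rw [Finset.sum_const, Finset.card_univ, Fintype.card_prod, Fintype.card_fin,
          nsmul_eq_mul, Nat.cast_mul, sq]

lemma abs_div_le_div_of_mul_le_mul {x b c κ : ℝ} (hx : 0 ≤ x) (hb : 0 < b) (hκ : 0 < κ)
    (h : κ * x ≤ c * b) : |x / b| ≤ c / κ := by
  rw [abs_of_nonneg (by positivity), div_le_div_iff₀ hb hκ]
  linarith

variable {p L s : ℕ} {n : Fin L → ℕ} {X : ∀ ℓ, Matrix (Fin (n ℓ)) (Fin p) ℝ} {γ₀ c₀ κ : ℝ}
  {S : Type*} [MeasurableSpace S] {μ : Measure S} {β : Fin L → S → Fin p → ℝ}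
  {ε : ∀ ℓ, S → Fin (n ℓ) → ℝ} {Ω : Matrix (Fin p) (Fin p) ℝ} {σ lam c₂ : ℝ} {τβ τε : ℝ≥0}
  {Ωhat : S → Matrix (Fin p) (Fin p) ℝ} [IsProbabilityMeasure μ]

namespace IsRandomEffects

lemma measure_exists_lt_abs_sampleScore_le (h : IsRandomEffects μ β ε Ω σ τβ τε)
    (hX : IsFixedDesign X γ₀ c₀ κ) (hγ₀ : 0 < γ₀) (hc₀ : 0 ≤ c₀) (hp : 0 < p) (hL : 0 < L)
    (hlog : Real.log p ≤ L)
    (hlam : 32 / scoreExponent τβ τε γ₀ c₀ * √(Real.log p / L) ≤ lam) :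
    μ {ω | ∃ i j, lam < |sampleScore X β ε Ω σ ω i j|} ≤ ENNReal.ofReal (2 / (p : ℝ) ^ 2) := by
  have hθ := scoreExponent_pos τβ τε γ₀ c₀
  have hp' : (0 : ℝ) < p := Nat.cast_pos.2 hp
  have hL' : (0 : ℝ) < L := Nat.cast_pos.2 hL
  have hlog0 : 0 ≤ Real.log p / L := div_nonneg (Real.log_natCast_nonneg p) hL'.le
  have hsqrt : √(Real.log p / L) ≤ 1 := Real.sqrt_le_one.2 ((div_le_one hL').2 hlog)
  set θ := scoreExponent τβ τε γ₀ c₀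
  set t : ℝ := 32 / θ * √(Real.log p / L) with ht
  have htθ : t * θ = 32 * √(Real.log p / L) := by
    rw [ht]
    field_simp
  have hexponent : L * t ^ 2 * θ ^ 2 / 256 = 4 * Real.log p := by
    rw [mul_assoc, ← mul_pow, htθ, mul_pow, Real.sq_sqrt hlog0]
    field_simp
    ring
  have hentry : ∀ i j, μ {ω | t ≤ |sampleScore X β ε Ω σ ω i j|}
      ≤ ENNReal.ofReal (2 / (p : ℝ) ^ 4) := fun i j => by
    rw [← ofReal_measureReal]
    refine ENNReal.ofReal_le_ofReal ((h.measureReal_le_abs_sampleScore_le hX hγ₀ hc₀ hL i j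
      (by positivity) (by linarith)).trans_eq ?_)
    rw [hexponent, ← neg_mul, mul_comm (-4), Real.exp_mul, Real.exp_log hp',
      Real.rpow_neg hp'.le, Real.rpow_ofNat, div_eq_mul_inv]
  calc μ {ω | ∃ i j, lam < |sampleScore X β ε Ω σ ω i j|}
      ≤ μ {ω | ∃ i j, t < |sampleScore X β ε Ω σ ω i j|} :=
        measure_mono fun ω ⟨i, j, hij⟩ => ⟨i, j, hlam.trans_lt hij⟩
    _ ≤ (p : ℝ≥0∞) ^ 2 * ENNReal.ofReal (2 / (p : ℝ) ^ 4) := measure_exists_lt_abs_apply_le hentry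
    _ = ENNReal.ofReal (2 / (p : ℝ) ^ 2) := by
        rw [← ENNReal.ofReal_natCast, ← ENNReal.ofReal_pow hp'.le,
          ← ENNReal.ofReal_mul (by positivity)]
        congr 1
        field_simp

lemma measure_exists_mul_sqrt_lt_abs_sampleScore_le (h : IsRandomEffects μ β ε Ω σ τβ τε)
    (hX : IsFixedDesign X γ₀ c₀ κ) (hγ₀ : 0 < γ₀) (hc₀ : 0 ≤ c₀) (hp : 2 ≤ p) (hL : 0 < L)
    {a : ℝ} (ha : 0 < a) :
    μ {ω | ∃ i j, a * √(Real.log p / L) < |sampleScore X β ε Ω σ ω i j|}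
      ≤ ENNReal.ofReal (32 * p ^ 2 / (scoreExponent τβ τε γ₀ c₀ * a) ^ 2) := by
  have hθ := scoreExponent_pos τβ τε γ₀ c₀
  have hlog : 1 / 2 ≤ Real.log p := by
    have hlog2 : Real.log 2 ≤ Real.log p := Real.log_le_log two_pos (by exact_mod_cast hp)
    linarith [Real.log_two_gt_d9]
  have hq : 0 < Real.log p / L := by positivity
  refine (measure_exists_lt_abs_apply_le fun i j =>
    h.measure_le_abs_sampleScore_le_div_sq hX hγ₀ hc₀ hL i j (by positivity)).trans ?_
  rw [← ENNReal.ofReal_natCast, ← ENNReal.ofReal_pow (Nat.cast_nonneg p),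
    ← ENNReal.ofReal_mul (by positivity)]
  refine ENNReal.ofReal_le_ofReal ?_
  set θ := scoreExponent τβ τε γ₀ c₀
  calc (p : ℝ) ^ 2 * (16 / (L * θ ^ 2 * (a * √(Real.log p / L)) ^ 2))
      = 16 * p ^ 2 / (θ * a) ^ 2 / Real.log p := by
        rw [mul_pow, Real.sq_sqrt hq.le]
        field_simp
    _ ≤ 16 * p ^ 2 / (θ * a) ^ 2 / (1 / 2) := by gcongr
    _ = 32 * p ^ 2 / (θ * a) ^ 2 := by ring

lemma measure_lt_abs_norm_sub_div_le_of_log_le (h : IsRandomEffects μ β ε Ω σ τβ τε)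
    (hX : IsFixedDesign X γ₀ c₀ κ) (hγ₀ : 0 < γ₀) (hc₀ : 0 ≤ c₀) (hκ : 0 < κ) (hp : 2 ≤ p)
    (hL : 0 < L) (hs : (offDiagSupport Ω).ncard ≤ s) (hlog : Real.log p ≤ L)
    (hlow : 32 / scoreExponent τβ τε γ₀ c₀ * √(Real.log p / L) ≤ lam)
    (hupp : lam ≤ c₂ * √(Real.log p / L))
    (hmin : ∀ᵐ ω ∂μ, IsPenalizedMinimizer X (fun ℓ => response (X ℓ) (β ℓ ω) (ε ℓ ω)) σ lam
      (Ωhat ω)) :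
    μ {ω | 2 * c₂ / κ < |‖Ωhat ω - Ω‖ / √(((p : ℝ) + s) * Real.log p / L)|}
      ≤ ENNReal.ofReal (2 / (p : ℝ) ^ 2) := by
  have hp0 : 0 < p := by omega
  have hθ := scoreExponent_pos τβ τε γ₀ c₀
  have hlogp : 0 < Real.log p := Real.log_pos (by exact_mod_cast hp)
  have hlam : 0 ≤ lam := le_trans (by positivity) hlow
  refine (measure_mono_ae ?_).trans
    (h.measure_exists_lt_abs_sampleScore_le hX hγ₀ hc₀ hp0 hL hlog hlow)
  filter_upwards [hmin] with ω hω hlarge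
  by_contra hsmall
  have hscore : ∀ i j, |sampleScore X β ε Ω σ ω i j| ≤ lam := fun i j =>
    not_lt.1 fun hlt => hsmall ⟨i, j, hlt⟩
  refine (abs_div_le_div_of_mul_le_mul (norm_nonneg _) (by positivity) hκ ?_).not_gt hlarge
  calc κ * ‖Ωhat ω - Ω‖ ≤ 2 * lam * √((p : ℝ) + (offDiagSupport Ω).ncard) :=
        hω.mul_norm_sub_le_of_abs_score_le (h.posSemidef hp0 ⟨0, hL⟩) hX hL hlam hscore
    _ ≤ 2 * (c₂ * √(Real.log p / L)) * √((p : ℝ) + s) := by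
        have hupp0 := hlam.trans hupp
        gcongr
    _ = 2 * c₂ * √(((p : ℝ) + s) * Real.log p / L) := by
        rw [mul_div_assoc, Real.sqrt_mul (by positivity)]
        ring

-- Chebyshev replaces Bernstein here; the bound is useful only for bounded `p`.
lemma measure_lt_abs_norm_sub_div_le_of_le (h : IsRandomEffects μ β ε Ω σ τβ τε)
    (hX : IsFixedDesign X γ₀ c₀ κ) (hγ₀ : 0 < γ₀) (hc₀ : 0 ≤ c₀) (hκ : 0 < κ) (hp : 2 ≤ p)
    {P : ℕ} (hpP : p ≤ P) (hL : 0 < L) (hlam : 0 ≤ lam) (hupp : lam ≤ c₂ * √(Real.log p / L))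
    {a δ : ℝ} (ha : 0 < a) (haδ : 32 * P ^ 2 / (scoreExponent τβ τε γ₀ c₀ * a) ^ 2 ≤ δ)
    (hmin : ∀ᵐ ω ∂μ, IsPenalizedMinimizer X (fun ℓ => response (X ℓ) (β ℓ ω) (ε ℓ ω)) σ lam
      (Ωhat ω)) :
    μ {ω | (a + c₂) * P / κ < |‖Ωhat ω - Ω‖ / √(((p : ℝ) + s) * Real.log p / L)|}
      ≤ ENNReal.ofReal δ := by
  have hp0 : 0 < p := by omega
  have hp1 : (1 : ℝ) ≤ p := Nat.one_le_cast.2 hp0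
  have hlogp : 0 < Real.log p := Real.log_pos (by exact_mod_cast hp)
  have hq : 0 < √(Real.log p / L) := by positivity
  have hc₂ : 0 ≤ c₂ := nonneg_of_mul_nonneg_left (hlam.trans hupp) hq
  have hp_le : (p : ℝ) ≤ P := Nat.cast_le.2 hpP
  refine (measure_mono_ae ?_).trans
    ((h.measure_exists_mul_sqrt_lt_abs_sampleScore_le hX hγ₀ hc₀ hp hL ha).trans
      (ENNReal.ofReal_le_ofReal (le_trans (by gcongr) haδ)))
  filter_upwards [hmin] with ω hω hlarge
  by_contra hsmall
  have hscore : ∀ i j, |sampleScore X β ε Ω σ ω i j| ≤ a * √(Real.log p / L) := fun i j =>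
    not_lt.1 fun hlt => hsmall ⟨i, j, hlt⟩
  refine (abs_div_le_div_of_mul_le_mul (norm_nonneg _) (by positivity) hκ ?_).not_gt hlarge
  calc κ * ‖Ωhat ω - Ω‖ ≤ (a * √(Real.log p / L) + lam) * p :=
        hω.mul_norm_sub_le (h.posSemidef hp0 ⟨0, hL⟩) hX hL hlam (by positivity) hscore
    _ ≤ (a * √(Real.log p / L) + c₂ * √(Real.log p / L)) * P := by gcongr
    _ = (a + c₂) * P * √(Real.log p / L) := by ring
    _ ≤ (a + c₂) * P * √(((p : ℝ) + s) * Real.log p / L) := by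
        gcongr
        exact le_mul_of_one_le_left hlogp.le (by linarith [Nat.cast_nonneg (α := ℝ) s])

end IsRandomEffects

lemma exists_forall_lt_two_div_sq_le {δ : ℝ} (hδ : 0 < δ) :
    ∃ P : ℕ, ∀ m : ℕ, P < m → 2 / (m : ℝ) ^ 2 ≤ δ := by
  refine eventually_atTop.1 ?_ |>.imp fun P hP m hm => hP m hm.le
  have hsq : Tendsto (fun m : ℕ => (m : ℝ) ^ 2) atTop atTop :=
    (tendsto_pow_atTop two_ne_zero).comp tendsto_natCast_atTop_atTop
  exact (hsq.const_div_atTop 2).eventually_le_const hδ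

lemma exists_pos_div_mul_sq_le {θ δ : ℝ} (hθ : 0 < θ) (hδ : 0 < δ) (B : ℝ) :
    ∃ a : ℝ, 0 < a ∧ B / (θ * a) ^ 2 ≤ δ := by
  have hsq : Tendsto (fun a : ℝ => (θ * a) ^ 2) atTop atTop :=
    (tendsto_pow_atTop two_ne_zero).comp (tendsto_id.const_mul_atTop hθ)
  exact ((eventually_gt_atTop 0).and
    ((hsq.const_div_atTop B).eventually_le_const hδ)).exists

end Rate

end HyperCov

theorem mainTheorem8_general (τβ τε : ℝ≥0) (γ₀ c₀ : ℝ) (hγ₀ : 0 < γ₀) (hc₀ : 0 ≤ c₀) :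
    ∃ C₀ : ℝ, 0 < C₀ ∧
      ∀ (κ : ℝ), 0 < κ →
      ∀ (p L s : ℕ → ℕ) (n : ∀ k, Fin (L k) → ℕ)
        (X : ∀ k, ∀ ℓ : Fin (L k), Matrix (Fin (n k ℓ)) (Fin (p k)) ℝ)
        (Ω : ∀ k, Matrix (Fin (p k)) (Fin (p k)) ℝ) (σ : ℕ → ℝ)
        (S : ℕ → Type*) [∀ k, MeasurableSpace (S k)]
        (μ : ∀ k, Measure (S k)) [∀ k, IsProbabilityMeasure (μ k)]
        (β : ∀ k, Fin (L k) → S k → Fin (p k) → ℝ)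
        (ε : ∀ k, ∀ ℓ : Fin (L k), S k → Fin (n k ℓ) → ℝ)
        (lam : ℕ → ℝ) (Ωhat : ∀ k, S k → Matrix (Fin (p k)) (Fin (p k)) ℝ),
        (∀ k, 2 ≤ p k) → (∀ k, 1 ≤ L k) →
        (∀ᶠ k in atTop, Real.log (p k) ≤ L k) →
        (∀ k, HyperCov.IsFixedDesign (X k) γ₀ c₀ κ) →
        (∀ k, HyperCov.IsRandomEffects (μ k) (β k) (ε k) (Ω k) (σ k) τβ τε) →
        (∀ k, (HyperCov.offDiagSupport (Ω k)).ncard ≤ s k) →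
        (∃ c₁ c₂ : ℝ, C₀ ≤ c₁ ∧ ∀ k, c₁ * √(Real.log (p k) / (L k : ℝ)) ≤ lam k ∧
          lam k ≤ c₂ * √(Real.log (p k) / (L k : ℝ))) →
        (∀ k, ∀ᵐ ω ∂(μ k), HyperCov.IsPenalizedMinimizer (X k)
          (fun ℓ => HyperCov.response (X k ℓ) (β k ℓ ω) (ε k ℓ ω)) (σ k) (lam k) (Ωhat k ω)) →
        HyperCov.IsBigOP μ (fun k ω => ‖Ωhat k ω - Ω k‖)
          (fun k => √(((p k : ℝ) + (s k : ℝ)) * Real.log (p k) / (L k : ℝ))) := by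
  have hθ := HyperCov.scoreExponent_pos τβ τε γ₀ c₀
  refine ⟨32 / HyperCov.scoreExponent τβ τε γ₀ c₀, by positivity, ?_⟩
  rintro κ hκ p L s n X Ω σ S _ μ _ β ε lam Ωhat hp hL hlog hX hR hs ⟨c₁, c₂, hc₁, hlam⟩ hmin
  have hlow : ∀ k, 32 / HyperCov.scoreExponent τβ τε γ₀ c₀ * √(Real.log (p k) / L k) ≤ lam k :=
    fun k => (mul_le_mul_of_nonneg_right hc₁ (Real.sqrt_nonneg _)).trans (hlam k).1
  refine HyperCov.isBigOP_of_large_of_bounded (p := p) (fun δ hδ => ?_) fun δ hδ P => ?_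
  · obtain ⟨P₁, hP₁⟩ := HyperCov.exists_forall_lt_imp_of_eventually hlog p
    obtain ⟨P₂, hP₂⟩ := HyperCov.exists_forall_lt_two_div_sq_le hδ
    refine ⟨max P₁ P₂, 2 * c₂ / κ, fun k hk => ?_⟩
    exact ((hR k).measure_lt_abs_norm_sub_div_le_of_log_le (hX k) hγ₀ hc₀ hκ (hp k) (hL k) (hs k)
      (hP₁ k ((le_max_left _ _).trans_lt hk)) (hlow k) (hlam k).2 (hmin k)).trans
      (ENNReal.ofReal_le_ofReal (hP₂ _ ((le_max_right _ _).trans_lt hk)))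
  · obtain ⟨a, ha, haδ⟩ := HyperCov.exists_pos_div_mul_sq_le hθ hδ (32 * (P : ℝ) ^ 2)
    refine ⟨(a + c₂) * P / κ, fun k hk => ?_⟩
    exact (hR k).measure_lt_abs_norm_sub_div_le_of_le (hX k) hγ₀ hc₀ hκ (hp k) hk (hL k)
      ((by positivity : (0 : ℝ) ≤ _).trans (hlow k)) (hlam k).2 ha haδ (hmin k)

theorem mainTheorem8 (τβ τε : ℝ≥0) (γ₀ c₀ : ℝ) (hγ₀ : 0 < γ₀) (hc₀ : 0 < c₀) :
    ∃ C₀ : ℝ, 0 < C₀ ∧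
      ∀ (κ : ℝ), 0 < κ →
      ∀ (p L s : ℕ → ℕ) (n : ∀ k, Fin (L k) → ℕ)
        (X : ∀ k, ∀ ℓ : Fin (L k), Matrix (Fin (n k ℓ)) (Fin (p k)) ℝ)
        (Ω : ∀ k, Matrix (Fin (p k)) (Fin (p k)) ℝ) (σ : ℝ)
        (S : ℕ → Type*) [∀ k, MeasurableSpace (S k)]
        (μ : ∀ k, Measure (S k)) [∀ k, IsProbabilityMeasure (μ k)]
        (β : ∀ k, Fin (L k) → S k → Fin (p k) → ℝ)
        (ε : ∀ k, ∀ ℓ : Fin (L k), S k → Fin (n k ℓ) → ℝ)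
        (lam : ℕ → ℝ) (Ωhat : ∀ k, S k → Matrix (Fin (p k)) (Fin (p k)) ℝ),
        (∀ k, 2 ≤ p k) → (∀ k, 1 ≤ L k) →
        Tendsto p atTop atTop →
        Tendsto (fun k => Real.log (p k) / (L k : ℝ)) atTop (𝓝 0) →
        (∀ k, HyperCov.IsFixedDesign (X k) γ₀ c₀ κ) →
        (∀ k, HyperCov.IsRandomEffects (μ k) (β k) (ε k) (Ω k) σ τβ τε) →
        (∀ k, (HyperCov.offDiagSupport (Ω k)).ncard ≤ s k) →
        (∃ c₁ c₂ : ℝ, C₀ ≤ c₁ ∧ ∀ k, c₁ * √(Real.log (p k) / (L k : ℝ)) ≤ lam k ∧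
          lam k ≤ c₂ * √(Real.log (p k) / (L k : ℝ))) →
        (∀ k, ∀ᵐ ω ∂(μ k), HyperCov.IsPenalizedMinimizer (X k)
          (fun ℓ => HyperCov.response (X k ℓ) (β k ℓ ω) (ε k ℓ ω)) σ (lam k) (Ωhat k ω)) →
        HyperCov.IsBigOP μ (fun k ω => ‖Ωhat k ω - Ω k‖)
          (fun k => √(((p k : ℝ) + (s k : ℝ)) * Real.log (p k) / (L k : ℝ))) := by
  obtain ⟨C₀, hC₀, hgeneral⟩ := mainTheorem8_general τβ τε γ₀ c₀ hγ₀ hc₀.le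
  refine ⟨C₀, hC₀, fun κ hκ p L s n X Ω σ S _ μ _ β ε lam Ωhat hp hL _ hlog => ?_⟩
  refine hgeneral κ hκ p L s n X Ω (fun _ => σ) S μ β ε lam Ωhat hp hL ?_
  filter_upwards [hlog.eventually_le_const one_pos] with k hk
  exact (div_le_one (Nat.cast_pos.2 (hL k))).1 hk
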